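/- \textbf{Setting.} An \emph{asymptotic couple} is a pair $(\Gamma,\psi)$ where $\Gamma$ is a (totally) ordered abelian group and $\psi:\Gamma^{\neq}\to\Gamma$, with $\Gamma^{\neq}:=\Gamma\setminus\{0\}$, satisfies for all $\alpha,\beta\in\Gamma^{\neq}$: (AC1) if $\alpha+\beta\neq 0$, then $\psi(\alpha+\beta)\geq\min(\psi(\alpha),\psi(\beta))$; (AC2) $\psi(r\alpha)=\psi(\alpha)$ for all $r\in\mathbb{Z}\setminus\{0\}$; (AC3) if $\alpha>0$, then $\alpha+\psi(\alpha)>\psi(\beta)$. It is of \emph{$H$-type} if $0<\alpha\leq\beta$ implies $\psi(\alpha)\geq\psi(\beta)$. Put $\Psi:=\psi(\Gamma^{\neq})$. The couple has \emph{asymptotic integration} if every $\alpha\in\Gamma$ equals $\gamma+\psi(\gamma)$ for some $\gamma\in\Gamma^{\neq}$; this $\gamma$ is then unique, we write $\gamma=\int\alpha$, and set $s\alpha:=\psi(\int\alpha)$. A \emph{model of $T_{\log}$} is an asymptotic couple of $H$-type with divisible $\Gamma$ and with asymptotic integration such that: the ordered set $\Psi$ has least element $s0$, and $s0>0$; each $\alpha\in\Psi$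 has $s\alpha$ as its immediate successor in $\Psi$; and $\alpha\mapsto s\alpha$ is a bijection $\Psi\to\Psi^{>s0}:=\{\beta\in\Psi:\beta>s0\}$, with inverse $p$. Such a model is viewed as a first-order structure with underlying set $\Gamma_\infty:=\Gamma\cup\{\infty\}$, where $\infty>\Gamma$, in the language $\{0,+,-,<,\psi,\infty,s,p,\delta_1,\delta_2,\dots\}$, where $\delta_n$ is division by $n$, $p=\infty$ outside $\Psi^{>s0}$, $\psi(0)=\infty$, and $-\infty$, $\psi(\infty)$, $s(\infty)$, $\delta_n(\infty)$, and every sum with a summand $\infty$, are $\infty$. ``Definable'' means first-order definable with parameters from the structure in question, and a function is definable if its graph is. \textbf{Theorem.} Let $(\Gamma,\psi)$ be a model of $T_{\log}$, let $n\geq 1$, and suppose that the function $f:\Psi^n\to\Psi$ is definable in $(\Gamma,\psi)$. Then $f$ is definable in the ordered set $(\Psi;<)$. -/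

import Mathlib

open FirstOrder

/-- An asymptotic couple `(Γ, ψ)` on an ordered abelian group `Γ`, with `ψ` defined on the nonzero
elements of `Γ`. -/
structure AsymptoticCouple (Γ : Type*) [AddCommGroup Γ] [LinearOrder Γ]
    [IsOrderedAddMonoid Γ] where
  /-- The map `ψ : Γ \ {0} → Γ`. -/
  psi : {γ : Γ // γ ≠ 0} → Γ
  ac1 : ∀ (α β : {γ : Γ // γ ≠ 0}) (h : (α : Γ) + β ≠ 0),
    min (psi α) (psi β) ≤ psi ⟨(α : Γ) + β, h⟩
  ac2 : ∀ (r : ℤ) (α : {γ : Γ // γ ≠ 0}) (_ : r ≠ 0) (h : r • (α : Γ) ≠ 0),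
    psi ⟨r • (α : Γ), h⟩ = psi α
  ac3 : ∀ α β : {γ : Γ // γ ≠ 0}, 0 < (α : Γ) → psi β < (α : Γ) + psi α

namespace AsymptoticCouple

variable {Γ : Type*} [AddCommGroup Γ] [LinearOrder Γ] [IsOrderedAddMonoid Γ]

/-- The set `Ψ = ψ(Γ \ {0})`. -/
def Psi (A : AsymptoticCouple Γ) : Set Γ := Set.range A.psi

/-- `γ' = γ + ψ(γ)` for nonzero `γ`. -/
def der (A : AsymptoticCouple Γ) (γ : {γ : Γ // γ ≠ 0}) : Γ := (γ : Γ) + A.psi γ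

/-- `(Γ, ψ)` is of `H`-type. -/
def IsHType (A : AsymptoticCouple Γ) : Prop :=
  ∀ α β : {γ : Γ // γ ≠ 0}, 0 < (α : Γ) → (α : Γ) ≤ β → A.psi β ≤ A.psi α

/-- The group `Γ` is divisible. -/
def IsDivisible (_A : AsymptoticCouple Γ) : Prop :=
  ∀ (n : ℕ+) (γ : Γ), ∃ δ : Γ, (n : ℕ) • δ = γ

/-- Asymptotic integration: every element of `Γ` is of the form `γ'` with `γ ≠ 0`. -/
def HasAsymptoticIntegration (A : AsymptoticCouple Γ) : Prop :=
  ∀ α : Γ, ∃ γ : {γ : Γ // γ ≠ 0}, A.der γ = α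

theorem der_ne_of_lt (A : AsymptoticCouple Γ) {a b : {γ : Γ // γ ≠ 0}}
    (hab : (b : Γ) < a) : A.der a ≠ A.der b := by
  intro h
  unfold der at h
  have hc : 0 < (a : Γ) - b := sub_pos.2 hab
  have e : A.psi b = (a : Γ) - b + A.psi a := by
    rw [sub_add_eq_add_sub, h, add_sub_cancel_left]
  have hlt : A.psi a < A.psi b := by rw [e]; exact lt_add_of_pos_left _ hc
  have hsum : ((⟨(a : Γ) - b, hc.ne'⟩ : {γ : Γ // γ ≠ 0}) : Γ) + b ≠ 0 := by
    simpa using a.2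
  have h1 := A.ac1 ⟨(a : Γ) - b, hc.ne'⟩ b hsum
  have e2 : (⟨((⟨(a : Γ) - b, hc.ne'⟩ : {γ : Γ // γ ≠ 0}) : Γ) + b, hsum⟩ :
      {γ : Γ // γ ≠ 0}) = a := Subtype.ext (by simp)
  rw [e2] at h1
  have h2 : A.psi ⟨(a : Γ) - b, hc.ne'⟩ ≤ A.psi a := by
    rcases min_le_iff.1 h1 with h | h
    · exact h
    · exact absurd h (not_le.2 hlt)
  have h3 := A.ac3 ⟨(a : Γ) - b, hc.ne'⟩ b hc
  have h4 : (a : Γ) - b + A.psi ⟨(a : Γ) - b, hc.ne'⟩ ≤ A.psi b := by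
    rw [e]; gcongr
  exact absurd h3 (not_lt.2 h4)

/-- The map `γ ↦ γ'` is injective, so integrals are unique. -/
theorem der_injective (A : AsymptoticCouple Γ) : Function.Injective A.der := by
  intro a b h
  rcases lt_trichotomy (a : Γ) b with hab | hab | hab
  · exact absurd h.symm (A.der_ne_of_lt hab)
  · exact Subtype.ext hab
  · exact absurd h (A.der_ne_of_lt hab)

/-- The integral `∫ α`: the unique nonzero `γ` with `γ' = α`. -/
noncomputable def integral (A : AsymptoticCouple Γ) (h : A.HasAsymptoticIntegration) (α : Γ) :
    {γ : Γ // γ ≠ 0} :=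
  (h α).choose

/-- The successor function `s α = ψ(∫ α)`. -/
noncomputable def succ (A : AsymptoticCouple Γ) (h : A.HasAsymptoticIntegration) (α : Γ) : Γ :=
  A.psi (A.integral h α)

/-- `(Γ, ψ)` is a model of `T_log`. -/
structure IsTlogModel (A : AsymptoticCouple Γ) : Prop where
  hType : A.IsHType
  divisible : A.IsDivisible
  integration : A.HasAsymptoticIntegration
  /-- `s 0` is the least element of `Ψ`, and is positive. -/
  isLeast_succ_zero : IsLeast A.Psi (A.succ integration 0)
  succ_zero_pos : 0 < A.succ integration 0
  /-- `s α` is the immediate successor of `α` in `Ψ`. -/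
  isLeast_succ : ∀ α ∈ A.Psi, IsLeast {β | β ∈ A.Psi ∧ α < β} (A.succ integration α)
  bijOn_succ : Set.BijOn (A.succ integration) A.Psi {β | β ∈ A.Psi ∧ A.succ integration 0 < β}

/-! ### The operations on `Γ ∪ {∞}` -/

open Classical in
/-- `ψ` on `Γ ∪ {∞}`, with `ψ(0) = ψ(∞) = ∞`. -/
noncomputable def psiTop (A : AsymptoticCouple Γ) : WithTop Γ → WithTop Γ
  | ⊤ => ⊤
  | (γ : Γ) => if h : γ ≠ 0 then (A.psi ⟨γ, h⟩ : WithTop Γ) else ⊤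

open Classical in
/-- `p` on `Γ ∪ {∞}`: the inverse of `s : Ψ → {β ∈ Ψ | β > s 0}`, and `∞` outside the latter
set. -/
noncomputable def predTop (A : AsymptoticCouple Γ) (h : A.IsTlogModel) : WithTop Γ → WithTop Γ
  | ⊤ => ⊤
  | (γ : Γ) =>
    if γ ∈ A.Psi ∧ A.succ h.integration 0 < γ then
      ((Function.invFunOn (A.succ h.integration) A.Psi γ : Γ) : WithTop Γ)
    else ⊤

/-- Division by `n ≥ 1` in `Γ`. -/
noncomputable def divBy (A : AsymptoticCouple Γ) (h : A.IsTlogModel) (n : ℕ+) (γ : Γ) : Γ :=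
  (h.divisible n γ).choose

end AsymptoticCouple

/-! ### Languages and structures -/

/-- Function symbols `0, ∞, +, -, ψ, s, p, δ₁, δ₂, …`. -/
inductive LogFunc : ℕ → Type
  | zero : LogFunc 0
  | infty : LogFunc 0
  | add : LogFunc 2
  | neg : LogFunc 1
  | psi : LogFunc 1
  | succ : LogFunc 1
  | pred : LogFunc 1
  | delta (n : ℕ+) : LogFunc 1

/-- A single binary relation symbol `<`. -/
inductive LtRel : ℕ → Type
  | lt : LtRel 2

/-- The language `L = {0, +, -, <, ψ, ∞, s, p, δ₁, δ₂, …}`. -/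
def logLanguage : Language := ⟨LogFunc, LtRel⟩

/-- The language `{<}`. -/
def ltLanguage : Language := ⟨fun _ => Empty, LtRel⟩

/-- An ordered set as a structure in the language `{<}`. -/
@[reducible] def ltStructure (S : Type*) [LinearOrder S] : ltLanguage.Structure S where
  funMap := fun f _ => nomatch f
  RelMap := fun {_} r v => match r, v with
    | LtRel.lt, v => v 0 < v 1

namespace AsymptoticCouple

variable {Γ : Type*} [AddCommGroup Γ] [LinearOrder Γ] [IsOrderedAddMonoid Γ]

/-- A model `(Γ, ψ)` of `T_log` as an `L`-structure with underlying set `Γ ∪ {∞}`. -/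
@[reducible] noncomputable def logStructure (A : AsymptoticCouple Γ) (h : A.IsTlogModel) :
    logLanguage.Structure (WithTop Γ) where
  funMap := fun {_} f v => match f, v with
    | LogFunc.zero, _ => ((0 : Γ) : WithTop Γ)
    | LogFunc.infty, _ => ⊤
    | LogFunc.add, v => v 0 + v 1
    | LogFunc.neg, v => WithTop.map (fun γ => -γ) (v 0)
    | LogFunc.psi, v => A.psiTop (v 0)
    | LogFunc.succ, v => WithTop.map (A.succ h.integration) (v 0)
    | LogFunc.pred, v => A.predTop h (v 0)
    | LogFunc.delta n, v => WithTop.map (A.divBy h n) (v 0)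
  RelMap := fun {_} r v => match r, v with
    | LtRel.lt, v => v 0 < v 1

/-- `f : Ψⁿ → Ψ` is definable (with parameters) in `(Γ, ψ)`: its graph, as a subset of
`(Γ ∪ {∞})ⁿ⁺¹`, is definable in the `L`-structure `Γ ∪ {∞}` with parameters from that structure. -/
def DefinableInCouple (A : AsymptoticCouple Γ) (h : A.IsTlogModel) {n : ℕ}
    (f : (Fin n → A.Psi) → A.Psi) : Prop :=
  letI := A.logStructure h
  (Set.univ : Set (WithTop Γ)).Definable logLanguage
    {v : Fin (n + 1) → WithTop Γ | ∃ x : Fin n → A.Psi,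
      (∀ i : Fin n, v i.castSucc = ((x i : Γ) : WithTop Γ)) ∧
        v (Fin.last n) = ((f x : Γ) : WithTop Γ)}

end AsymptoticCouple

/-- `f : Sⁿ → S` is definable (with parameters) in the ordered set `(S; <)`: its graph, as a subset
of `Sⁿ⁺¹`, is definable in the language `{<}` with parameters from `S`. -/
def DefinableInOrder {S : Type*} [LinearOrder S] {n : ℕ} (f : (Fin n → S) → S) : Prop :=
  letI := ltStructure S
  (Set.univ : Set S).Definable ltLanguage
    {v : Fin (n + 1) → S | v (Fin.last n) = f (fun i => v i.castSucc)}

-- The argument shows more: every subset of Ψ^m definable in (Γ,ψ) is definable in (Ψ;<). Regard Γ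
-- as an ordered vector space over ℚ with the convex valuation ψ (`LogVal`). The remaining structure
-- is the inclusion of Ψ in Γ, governed by two facts: ψ(α-β) = sα for α < β in Ψ, and sα is the only
-- z ∈ Ψ with ψ(α-z) = z.
--
-- Quantifier-free relations (`QF`) locate linear combinations of group elements and elements of Ψ
-- relative to balls around 0. A quantifier over Γ can be eliminated from them (`QF.exists_adj`):
-- each condition cuts out a convex set of the quantified variable, and by Helly's theorem only
-- pairs of conditions have to be compatible.
--
-- Quantifiers over Ψ are not eliminated. Instead one follows relations R(x,y), y a tuple in Ψ,
-- whose fibre over x is given by one order formula with parameters in Ψ chosen from x in a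
-- quantifier-free way (`Fib`). This class is closed under Boolean operations and quantification
-- over Ψ. It contains `QF` (`Fib.of_qf`), and hence is closed under quantification over Γ
-- (`Fib.exists_adj`). Induction on formulas then covers all definable relations; over a one-point
-- space, `Fib` is order-definability.
--
-- The heart is `Fib.sg_sum`, on the position of l(x) + ∑ c_k y_k. After recentring the y_k at a
-- suitable b ∈ Ψ determined by x, the term with least y_k dominates the sum. Either it or the
-- remaining group element decides the position, or their values agree; then that y_k is determined
-- by x, and the sum gets shorter.

universe u

/-- A convex valuation on an ordered group whose value set embeds into the group as a
pseudo-Cauchy sequence without pseudolimit. -/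
structure LogVal (Γ S : Type u) [AddCommGroup Γ] [LinearOrder Γ] [IsOrderedAddMonoid Γ]
    [LinearOrder S] where
  /-- The valuation. -/
  val : Γ → WithTop S
  /-- The embedding of the value set into the group. -/
  emb : S → Γ
  /-- The immediate successor in the value set. -/
  sc : S → S
  /-- The value of the integral. -/
  int : Γ → S
  val_eq_top : ∀ a, val a = ⊤ ↔ a = 0
  val_add : ∀ a b, min (val a) (val b) ≤ val (a + b)
  val_zsmul : ∀ (n : ℤ) a, n ≠ 0 → val (n • a) = val a
  val_anti : ∀ a b, 0 ≤ a → a ≤ b → val b ≤ val a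
  val_surj : ∀ z : S, ∃ a, val a = z
  sc_le : ∀ z w, sc z ≤ w ↔ z < w
  val_emb_sub : ∀ z w, z < w → val (emb z - emb w) = sc z
  emb_lt : ∀ z w, z < w → emb z < emb w
  val_int : ∀ a, val (a - emb (int a)) = int a

/-! ### Rational scalars on a divisible ordered group. -/

/-- A divisible ordered abelian group is a vector space over `ℚ`. -/
theorem nonempty_module_rat {Γ : Type*} [AddCommGroup Γ] [LinearOrder Γ] [IsOrderedAddMonoid Γ]
    (h : ∀ (n : ℕ+) (γ : Γ), ∃ δ : Γ, (n : ℕ) • δ = γ) : Nonempty (Module ℚ Γ) := by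
  have hd : ∀ (q : ℚ) (γ : Γ), ∃ δ : Γ, (q.den : ℤ) • δ = q.num • γ := by
    intro q γ
    obtain ⟨δ, hδ⟩ := h ⟨q.den, q.den_pos⟩ (q.num • γ)
    exact ⟨δ, by simpa using hδ⟩
  choose f hf using hd
  -- By torsion-freeness any fraction representing `q` characterises `f q γ`; each module axiom is
  -- then an identity between integer multiples.
  have key : ∀ (q : ℚ) (m n : ℤ) (γ δ : Γ), n ≠ 0 → q = m / n → n • δ = m • γ → f q γ = δ := by
    intro q m n γ δ hn hq e
    have hden : (q.den : ℤ) ≠ 0 := by exact_mod_cast q.den_nz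
    have hcr : q.num * n = m * q.den := by
      have h1 : (n : ℚ) ≠ 0 := by exact_mod_cast hn
      have h2 : (q.den : ℚ) ≠ 0 := by exact_mod_cast q.den_nz
      have h3 : (q.num : ℚ) / q.den = m / n := by rw [Rat.num_div_den, hq]
      rw [div_eq_div_iff h2 h1] at h3
      exact_mod_cast h3
    apply zsmul_right_injective (mul_ne_zero hn hden)
    change (n * (q.den : ℤ)) • f q γ = (n * (q.den : ℤ)) • δ
    rw [mul_smul, hf, smul_smul, mul_comm n q.num, hcr, mul_comm n, mul_smul _ n, e, smul_smul,
      mul_comm m]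
  refine ⟨
    { smul := f
      one_smul := fun γ => key 1 1 1 γ γ one_ne_zero (by simp) (by simp)
      mul_smul := fun p q γ => ?_
      smul_zero := fun q => key q q.num q.den 0 0 (by exact_mod_cast q.den_nz)
        (by simp [Rat.num_div_den]) (by simp)
      smul_add := fun q a b => ?_
      add_smul := fun p q a => ?_
      zero_smul := fun a => key 0 0 1 a 0 one_ne_zero (by simp) (by simp) }⟩
  · have hp : (p.den : ℚ) ≠ 0 := by exact_mod_cast p.den_nz
    have hq : (q.den : ℚ) ≠ 0 := by exact_mod_cast q.den_nz
    refine key (p * q) (p.num * q.num) (q.den * p.den) γ _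
      (mul_ne_zero (by exact_mod_cast q.den_nz) (by exact_mod_cast p.den_nz)) ?_ ?_
    · push_cast
      rw [mul_comm (q.den : ℚ), mul_div_mul_comm, Rat.num_div_den, Rat.num_div_den]
    · change ((q.den : ℤ) * p.den) • f p (f q γ) = _
      rw [mul_smul, hf, smul_smul, mul_comm, mul_smul, hf, smul_smul]
  · refine key q q.num q.den (a + b) _ (by exact_mod_cast q.den_nz)
        (by simp [Rat.num_div_den]) ?_
    change (q.den : ℤ) • (f q a + f q b) = _
    rw [smul_add, smul_add, hf, hf]
  · have hp : (p.den : ℚ) ≠ 0 := by exact_mod_cast p.den_nz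
    have hq : (q.den : ℚ) ≠ 0 := by exact_mod_cast q.den_nz
    refine key (p + q) (p.num * q.den + q.num * p.den) (p.den * q.den) a _
      (mul_ne_zero (by exact_mod_cast p.den_nz) (by exact_mod_cast q.den_nz)) ?_ ?_
    · push_cast
      conv_lhs => rw [← Rat.num_div_den p, ← Rat.num_div_den q]
      rw [div_add_div _ _ hp hq, mul_comm (q.num : ℚ)]
    · change ((p.den : ℤ) * q.den) • (f p a + f q a) = _
      rw [smul_add, add_smul, mul_comm, mul_smul, hf, mul_comm, mul_smul, hf, smul_smul,
        smul_smul, mul_comm (q.den : ℤ), mul_comm (p.den : ℤ)]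

section Order

variable {Γ : Type*} [AddCommGroup Γ] [LinearOrder Γ] [IsOrderedAddMonoid Γ] [Module ℚ Γ]

theorem rat_smul_pos {q : ℚ} (hq : 0 < q) {a : Γ} (ha : 0 < a) : 0 < q • a := by
  by_contra hn
  have h1 : q.den • (q • a) = q.num.toNat • a := by
    have h2 : ((q.num.toNat : ℤ)) = q.num := Int.toNat_of_nonneg (Rat.num_pos.2 hq).le
    have h3 : ((q.num.toNat : ℕ) : ℚ) = q.num := by exact_mod_cast h2
    rw [← Nat.cast_smul_eq_nsmul ℚ, ← Nat.cast_smul_eq_nsmul ℚ, smul_smul, h3,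
      Rat.den_mul_eq_num]
  have h4 : q.den • (q • a) ≤ 0 := nsmul_nonpos (not_lt.1 hn) _
  have h5 : 0 < q.num.toNat • a := nsmul_pos ha (by have := Rat.num_pos.2 hq; omega)
  rw [h1] at h4
  exact absurd h5 (not_lt.2 h4)

end Order

/-! ### The valuation attached to a model of T_log. -/

namespace AsymptoticCouple

variable {Γ : Type u} [AddCommGroup Γ] [LinearOrder Γ] [IsOrderedAddMonoid Γ]

theorem sub_psi_integral (A : AsymptoticCouple Γ) (h : A.HasAsymptoticIntegration) (a : Γ) :
    a - A.succ h a = A.integral h a := by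
  have h1 : A.der (A.integral h a) = a := (h a).choose_spec
  unfold succ
  rw [sub_eq_iff_eq_add]
  exact h1.symm

open Classical in
/-- The valuation with values in `Ψ ∪ {∞}`. -/
noncomputable def toVal (A : AsymptoticCouple Γ) (a : Γ) : WithTop A.Psi :=
  if h : a = 0 then ⊤ else ((⟨A.psi ⟨a, h⟩, ⟨_, rfl⟩⟩ : A.Psi) : WithTop A.Psi)

theorem toVal_of_ne (A : AsymptoticCouple Γ) {a : Γ} (h : a ≠ 0) :
    A.toVal a = ((⟨A.psi ⟨a, h⟩, ⟨_, rfl⟩⟩ : A.Psi) : WithTop A.Psi) := dif_neg h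

theorem toVal_zero (A : AsymptoticCouple Γ) : A.toVal 0 = ⊤ := dif_pos rfl

/-- With x = ∫a and y = ∫b one has a - b = (x - y) - (ψy - ψx). Here ψ(x - y) = ψx because ψx < ψy,
and (AC3) gives ψ(ψy - ψx) > ψx, so the first summand determines ψ. -/
theorem psi_sub_of_succ_lt (A : AsymptoticCouple Γ) (hA : A.IsTlogModel) {a b : Γ}
    (hab : A.succ hA.integration a < A.succ hA.integration b) (hne : a - b ≠ 0) :
    A.psi ⟨a - b, hne⟩ = A.succ hA.integration a := by
  set x := A.integral hA.integration a with hx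
  set y := A.integral hA.integration b with hy
  have ex : a = x + A.psi x := ((hA.integration a).choose_spec).symm
  have ey : b = y + A.psi y := ((hA.integration b).choose_spec).symm
  change A.psi x < A.psi y at hab
  change _ = A.psi x
  have neg : ∀ (c : Γ) (h : c ≠ 0) (h' : -c ≠ 0), A.psi ⟨-c, h'⟩ = A.psi ⟨c, h⟩ := by
    intro c h h'
    have := A.ac2 (-1) ⟨c, h⟩ (by norm_num) (by simpa using h)
    simpa using this
  have dom : ∀ (c d : Γ) (hc : c ≠ 0) (hd : d ≠ 0) (hcd : c + d ≠ 0),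
      A.psi ⟨c, hc⟩ < A.psi ⟨d, hd⟩ → A.psi ⟨c + d, hcd⟩ = A.psi ⟨c, hc⟩ := by
    intro c d hc hd hcd hlt
    apply le_antisymm
    · have h1 := A.ac1 ⟨c + d, hcd⟩ ⟨-d, neg_ne_zero.2 hd⟩ (by simpa using hc)
      rw [neg d hd] at h1
      simp only [add_neg_cancel_right] at h1
      rcases min_le_iff.1 h1 with h | h
      · exact h
      · exact absurd h (not_le.2 hlt)
    · have h1 := A.ac1 ⟨c, hc⟩ ⟨d, hd⟩ hcd
      rwa [min_eq_left hlt.le] at h1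
  have hd : 0 < A.psi y - A.psi x := sub_pos.2 hab
  have h3 : A.psi x < A.psi ⟨A.psi y - A.psi x, hd.ne'⟩ := by
    have := A.ac3 ⟨_, hd.ne'⟩ y hd
    dsimp only at this
    rw [sub_add_eq_add_sub, lt_sub_iff_add_lt] at this
    exact lt_of_add_lt_add_left this
  have hxy : (x : Γ) + -y ≠ 0 := by
    intro h
    have : x = y := Subtype.ext (by rwa [← sub_eq_add_neg, sub_eq_zero] at h)
    rw [this] at hab
    exact lt_irrefl _ hab
  have h4 : A.psi ⟨(x : Γ) + -y, hxy⟩ = A.psi x := by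
    apply dom _ _ x.2 (neg_ne_zero.2 y.2) hxy
    rw [neg _ y.2]
    exact hab
  have h5 : A.psi x < A.psi ⟨-(A.psi y - A.psi x), neg_ne_zero.2 hd.ne'⟩ := by
    rwa [neg _ hd.ne']
  have e : a - b = (x + -y) + -(A.psi y - A.psi x) := by
    rw [ex, ey]; abel
  have h6 := dom _ _ hxy (neg_ne_zero.2 hd.ne') (by rwa [← e]) (by rwa [h4])
  rw [← h4, ← h6]
  congr 2

/-- The valuation structure of a model of `T_log`. -/
noncomputable def toLogVal (A : AsymptoticCouple Γ) (hA : A.IsTlogModel) :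
    LogVal Γ A.Psi where
  val := A.toVal
  emb := fun z => z
  sc := fun z => ⟨A.succ hA.integration z, ⟨_, rfl⟩⟩
  int := fun a => ⟨A.succ hA.integration a, ⟨_, rfl⟩⟩
  val_eq_top := by
    intro a
    unfold toVal
    split_ifs with h <;> simp [h]
  val_add := by
    intro a b
    by_cases ha : a = 0
    · simp [ha]
    by_cases hb : b = 0
    · simp [hb]
    by_cases hab : a + b = 0
    · simp [hab, toVal_zero]
    rw [A.toVal_of_ne ha, A.toVal_of_ne hb, A.toVal_of_ne hab]
    have := A.ac1 ⟨a, ha⟩ ⟨b, hb⟩ hab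
    rcases min_le_iff.1 this with h | h
    · exact min_le_of_left_le (WithTop.coe_le_coe.2 h)
    · exact min_le_of_right_le (WithTop.coe_le_coe.2 h)
  val_zsmul := by
    intro n a hn
    by_cases ha : a = 0
    · simp [ha]
    have hna : n • a ≠ 0 := by simp [hn, ha]
    rw [A.toVal_of_ne ha, A.toVal_of_ne hna]
    congr 2
    exact A.ac2 n ⟨a, ha⟩ hn hna
  val_anti := by
    intro a b ha hab
    rcases ha.eq_or_lt with ha | ha
    · simp [← ha, toVal_zero]
    · rw [A.toVal_of_ne ha.ne', A.toVal_of_ne (ha.trans_le hab).ne']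
      exact WithTop.coe_le_coe.2 (hA.hType ⟨a, ha.ne'⟩ ⟨b, _⟩ ha hab)
  val_surj := by
    rintro ⟨_, ⟨a, rfl⟩⟩
    exact ⟨a, A.toVal_of_ne a.2⟩
  sc_le := by
    intro z w
    have h := hA.isLeast_succ z z.2
    exact ⟨fun hzw => lt_of_lt_of_le (b := (⟨A.succ hA.integration z, ⟨_, rfl⟩⟩ : A.Psi)) h.1.2 hzw,
      fun hzw => h.2 ⟨w.2, hzw⟩⟩
  val_emb_sub := by
    intro z w hzw
    have hne : (z : Γ) - w ≠ 0 := (sub_neg.2 (show (z : Γ) < w from hzw)).ne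
    have h1 := hA.isLeast_succ z z.2
    have h2 := hA.isLeast_succ w w.2
    rw [A.toVal_of_ne hne]
    congr 2
    exact A.psi_sub_of_succ_lt hA ((h1.2 ⟨w.2, hzw⟩).trans_lt h2.1.2) hne
  emb_lt := fun z w h => h
  val_int := by
    intro a
    have := A.sub_psi_integral hA.integration a
    change A.toVal (a - A.succ hA.integration a) = _
    rw [this, A.toVal_of_ne (A.integral hA.integration a).2]
    rfl

end AsymptoticCouple

/-! ### Positions relative to balls, and when two of them can be prescribed. -/

namespace LogVal

variable {Γ S : Type u} [AddCommGroup Γ] [LinearOrder Γ] [IsOrderedAddMonoid Γ]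
  [LinearOrder S] (V : LogVal Γ S)

theorem val_zero : V.val 0 = ⊤ := (V.val_eq_top 0).2 rfl

theorem val_neg (a : Γ) : V.val (-a) = V.val a := by
  simpa using V.val_zsmul (-1) a (by norm_num)

theorem le_val_add {w : WithTop S} {a b : Γ} (ha : w ≤ V.val a) (hb : w ≤ V.val b) :
    w ≤ V.val (a + b) := (le_min ha hb).trans (V.val_add a b)

theorem le_val_sub {w : WithTop S} {a b : Γ} (ha : w ≤ V.val a) (hb : w ≤ V.val b) :
    w ≤ V.val (a - b) := by
  rw [sub_eq_add_neg]
  exact V.le_val_add ha (by rwa [val_neg])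

theorem val_add_eq {a b : Γ} (h : V.val a < V.val b) : V.val (a + b) = V.val a := by
  apply le_antisymm
  · by_contra hn
    have h1 := V.val_add (a + b) (-b)
    rw [add_neg_cancel_right, V.val_neg] at h1
    exact absurd h1 (not_le.2 (lt_min (not_le.1 hn) h))
  · exact V.le_val_add le_rfl h.le

theorem add_pos_of_val_lt {a b : Γ} (h : V.val a < V.val b) (ha : 0 < a) : 0 < a + b := by
  by_contra hn
  have h1 : a ≤ -b := by rw [le_neg_iff_add_nonpos_right]; exact not_lt.1 hn
  have h2 := V.val_anti a (-b) ha.le h1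
  rw [V.val_neg] at h2
  exact absurd h (not_lt.2 h2)

theorem sign_add_eq {a b : Γ} (h : V.val a < V.val b) :
    SignType.sign (a + b) = SignType.sign a := by
  rcases lt_trichotomy a 0 with ha | ha | ha
  · have h1 : 0 < -a + -b :=
      V.add_pos_of_val_lt (by rwa [V.val_neg, V.val_neg]) (neg_pos.2 ha)
    rw [← neg_add] at h1
    rw [sign_neg ha, sign_neg (neg_pos.1 h1)]
  · rw [ha, V.val_zero] at h
    exact absurd h not_top_lt
  · rw [sign_pos ha, sign_pos (V.add_pos_of_val_lt h ha)]

/-- The position of `a` relative to the ball of elements of value at least `w`. -/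
noncomputable def sg (a : Γ) (w : WithTop S) : SignType :=
  if w ≤ V.val a then 0 else SignType.sign a

/-- The summand of smaller value dominates in size, so it fixes both the value and the sign of the
sum. -/
theorem sg_add_eq {a b : Γ} (h : V.val a < V.val b) (w : WithTop S) :
    V.sg (a + b) w = V.sg a w := by
  unfold sg
  rw [V.val_add_eq h, V.sign_add_eq h]

theorem sg_eq_zero {a : Γ} {w : WithTop S} : V.sg a w = 0 ↔ w ≤ V.val a := by
  unfold sg
  split_ifs with h
  · simp [h]
  · simp only [h, iff_false, sign_eq_zero_iff]
    rintro rfl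
    exact h (by rw [V.val_zero]; exact le_top)

theorem sg_eq_one {a : Γ} {w : WithTop S} : V.sg a w = 1 ↔ 0 < a ∧ V.val a < w := by
  unfold sg
  split_ifs with h
  · simp [not_lt.2 h]
  · simp [sign_eq_one_iff, not_le.1 h]

theorem sg_neg (a : Γ) (w : WithTop S) : V.sg (-a) w = - V.sg a w := by
  unfold sg
  rw [V.val_neg]
  split_ifs with h
  · rfl
  · exact Left.sign_neg a

theorem sg_eq_neg_one {a : Γ} {w : WithTop S} : V.sg a w = -1 ↔ a < 0 ∧ V.val a < w := by
  rw [← neg_pos, ← V.val_neg, ← V.sg_eq_one, V.sg_neg, neg_eq_iff_eq_neg]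

theorem sg_top (a : Γ) : V.sg a ⊤ = SignType.sign a := by
  unfold sg
  split_ifs with h
  · rw [(V.val_eq_top a).1 (top_le_iff.1 h), sign_zero]
  · rfl

theorem le_val_sum {ι : Type*} (F : Finset ι) (f : ι → Γ) {w : WithTop S}
    (h : ∀ i ∈ F, w ≤ V.val (f i)) : w ≤ V.val (∑ i ∈ F, f i) := by
  classical
  induction F using Finset.induction_on with
  | empty => simp [V.val_zero]
  | insert i F hi ih =>
    rw [Finset.sum_insert hi]
    exact V.le_val_add (h i (Finset.mem_insert_self i F))
      (ih fun k hk => h k (Finset.mem_insert_of_mem hk))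

theorem lt_sc (z : S) : z < V.sc z := (V.sc_le z _).1 le_rfl

theorem lt_sc_iff {z w : S} : z < V.sc w ↔ z ≤ w := by
  rw [← not_le, V.sc_le, not_lt]

theorem sc_lt_sc {z w : S} : V.sc z < V.sc w ↔ z < w := by
  rw [V.lt_sc_iff, V.sc_le]

theorem sc_injective : Function.Injective V.sc :=
  StrictMono.injective fun _ _ => V.sc_lt_sc.2

theorem sc_le_coe {z : S} {w : WithTop S} :
    ((V.sc z : S) : WithTop S) ≤ w ↔ (z : WithTop S) < w := by
  induction w using WithTop.recTopCoe with
  | top => simp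
  | coe w => rw [WithTop.coe_le_coe, WithTop.coe_lt_coe, V.sc_le]

/-- Discreteness of the value set turns an exact value into two ball conditions; this is why
successors are admitted as thresholds. -/
theorem val_eq_coe_iff {a : Γ} {z : S} :
    V.val a = z ↔ V.sg a z = 0 ∧ V.sg a (V.sc z) ≠ 0 := by
  rw [ne_eq, sg_eq_zero, sg_eq_zero, sc_le_coe, not_lt, and_comm]
  exact le_antisymm_iff

theorem exists_pos_val (z : S) : ∃ a, 0 < a ∧ V.val a = z := by
  obtain ⟨a, ha⟩ := V.val_surj z
  rcases lt_trichotomy a 0 with h | h | h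
  · exact ⟨-a, neg_pos.2 h, by rw [V.val_neg, ha]⟩
  · rw [h, V.val_zero] at ha
    exact absurd ha WithTop.top_ne_coe
  · exact ⟨a, h, ha⟩

theorem exists_pos_mem_ball {w w' : WithTop S} (h : w < w') :
    ∃ a, V.sg a w = 0 ∧ V.sg a w' = 1 := by
  lift w to S using h.ne_top
  obtain ⟨a, ha, hv⟩ := V.exists_pos_val w
  exact ⟨a, V.sg_eq_zero.2 hv.ge, V.sg_eq_one.2 ⟨ha, by rwa [hv]⟩⟩

/-- Balls around `0` are order convex. -/
theorem le_val_of_between {a b : Γ} {w : WithTop S} (ha : 0 ≤ a) (hab : a ≤ b)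
    (hb : w ≤ V.val b) : w ≤ V.val a := hb.trans (V.val_anti a b ha hab)

/-- `sg` is monotone in its first argument. -/
theorem sg_mono (w : WithTop S) : Monotone (fun a => V.sg a w) := by
  intro a b hab
  change V.sg a w ≤ V.sg b w
  by_contra hn
  rw [not_le] at hn
  rcases h1 : V.sg a w with _ | _ | _ <;> rcases h2 : V.sg b w with _ | _ | _ <;>
    rw [h1, h2] at hn <;> try exact absurd hn (by decide)
  · obtain ⟨hb, hv⟩ := V.sg_eq_neg_one.1 h2
    have := V.le_val_of_between (w := w) (neg_nonneg.2 hb.le) (neg_le_neg hab)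
      (by rw [V.val_neg]; exact V.sg_eq_zero.1 h1)
    rw [V.val_neg] at this
    exact absurd hv (not_lt.2 this)
  · obtain ⟨ha, hv⟩ := V.sg_eq_one.1 h1
    exact absurd hv (not_lt.2 (V.le_val_of_between ha.le hab (V.sg_eq_zero.1 h2)))
  · exact absurd ((V.sg_eq_one.1 h1).1.trans_le hab) (V.sg_eq_neg_one.1 h2).1.not_gt

theorem ordConnected_sg (a : Γ) (w : WithTop S) (e : SignType) :
    {u | V.sg (u + a) w = e}.OrdConnected := by
  refine ⟨fun x hx y hy z hz => ?_⟩
  have h1 := V.sg_mono w (add_le_add_left hz.1 a)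
  have h2 := V.sg_mono w (add_le_add_left hz.2 a)
  simp only [Set.mem_ofPred_eq] at *
  rw [hx] at h1
  rw [hy] at h2
  exact le_antisymm h2 h1

/-- A sufficiently large `u` works unless one of the balls is the whole group, that is, unless no
value lies below its threshold. -/
theorem exists_sg_one_one (d : Γ) (w w' : WithTop S) :
    (∃ u, V.sg u w = 1 ∧ V.sg (u - d) w' = 1) ↔
      ∃ z : S, (z : WithTop S) < w ∧ (z : WithTop S) < w' := by
  constructor
  · rintro ⟨u, h1, h2⟩
    have h3 := (V.sg_eq_one.1 h1).2
    have h4 := (V.sg_eq_one.1 h2).2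
    rcases le_total (V.val u) (V.val (u - d)) with h | h
    · lift V.val u to S using h3.ne_top with z
      exact ⟨z, h3, h.trans_lt h4⟩
    · lift V.val (u - d) to S using h4.ne_top with z
      exact ⟨z, h.trans_lt h3, h4⟩
  · rintro ⟨z, h1, h2⟩
    obtain ⟨a, ha, hv⟩ := V.exists_pos_val z
    rw [← hv] at h1 h2
    have h3 : V.sg a w = 1 := V.sg_eq_one.2 ⟨ha, h1⟩
    have h4 : V.sg a w' = 1 := V.sg_eq_one.2 ⟨ha, h2⟩
    refine ⟨|d| + a, le_antisymm (SignType.le_one _) ?_, le_antisymm (SignType.le_one _) ?_⟩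
    · rw [← h3]
      exact V.sg_mono w (le_add_of_nonneg_left (abs_nonneg d))
    · rw [← h4]
      refine V.sg_mono w' ?_
      rw [add_sub_right_comm]
      exact le_add_of_nonneg_left (sub_nonneg.2 (le_abs_self d))

/-- Two balls centred at 0 and `d` meet exactly when the larger radius reaches from one centre to
the other. -/
theorem exists_sg_zero_zero (d : Γ) (w w' : WithTop S) :
    (∃ u, V.sg u w = 0 ∧ V.sg (u - d) w' = 0) ↔ V.sg d w = 0 ∨ V.sg d w' = 0 := by
  simp only [sg_eq_zero]
  constructor
  · rintro ⟨u, h1, h2⟩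
    have e : d = u - (u - d) := (sub_sub_cancel u d).symm
    rcases le_total w w' with h | h
    · left
      rw [e]
      exact V.le_val_sub h1 (h.trans h2)
    · right
      rw [e]
      exact V.le_val_sub (h.trans h1) h2
  · rintro (h | h)
    · exact ⟨d, h, by rw [sub_self, V.val_zero]; exact le_top⟩
    · exact ⟨0, by rw [V.val_zero]; exact le_top, by rwa [zero_sub, V.val_neg]⟩

/-- If `d` dominates `u`, the sign of `u - d` is that of `-d`. Otherwise `d` lies in the ball of
`u`, and then so does `u - d`, which must nevertheless escape the second ball. -/
theorem exists_sg_zero_one (d : Γ) (w w' : WithTop S) :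
    (∃ u, V.sg u w = 0 ∧ V.sg (u - d) w' = 1) ↔
      V.sg d w' = -1 ∨ (w < w' ∧ V.sg d w = 0) := by
  constructor
  · rintro ⟨u, h1, h2⟩
    rw [sg_eq_zero] at h1
    by_cases hd : V.val d < V.val u
    · left
      rw [← V.val_neg d] at hd
      rw [sub_eq_neg_add, V.sg_add_eq hd, V.sg_neg] at h2
      rw [← h2, neg_neg]
    · rw [not_lt] at hd
      refine or_iff_not_imp_left.2 fun _ => ⟨?_, V.sg_eq_zero.2 (h1.trans hd)⟩
      exact (V.le_val_sub h1 (h1.trans hd)).trans_lt (V.sg_eq_one.1 h2).2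
  · rintro (h | ⟨h1, h2⟩)
    · exact ⟨0, by rw [V.sg_eq_zero, V.val_zero]; exact le_top,
        by rw [zero_sub, V.sg_neg, h, neg_neg]⟩
    · obtain ⟨a, h3, h4⟩ := V.exists_pos_mem_ball h1
      rw [sg_eq_zero] at h2 h3
      exact ⟨d + a, V.sg_eq_zero.2 (V.le_val_add h2 h3), by rwa [add_sub_cancel_left]⟩

/-- The reflection `u ↦ -u`, together with the translation in `exists_sg_swap`, reduces the nine
sign pairs to four. -/
theorem exists_sg_neg (e e' : SignType) (d : Γ) (w w' : WithTop S) :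
    (∃ u, V.sg u w = e ∧ V.sg (u - d) w' = e') ↔
      ∃ u, V.sg u w = -e ∧ V.sg (u - -d) w' = -e' := by
  constructor
  · rintro ⟨u, rfl, rfl⟩
    exact ⟨-u, V.sg_neg u w, by rw [← V.sg_neg, neg_sub, sub_neg_eq_add, neg_add_eq_sub]⟩
  · rintro ⟨u, h1, h2⟩
    exact ⟨-u, by rw [V.sg_neg, h1, neg_neg],
      by rw [← neg_neg e', ← h2, ← V.sg_neg, neg_sub]; congr 1; abel⟩

theorem exists_sg_swap (e e' : SignType) (d : Γ) (w w' : WithTop S) :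
    (∃ u, V.sg u w = e ∧ V.sg (u - d) w' = e') ↔
      ∃ u, V.sg u w' = e' ∧ V.sg (u - -d) w = e := by
  constructor
  · rintro ⟨u, h1, h2⟩
    exact ⟨u - d, h2, by rwa [sub_neg_eq_add, sub_add_cancel]⟩
  · rintro ⟨u, h1, h2⟩
    exact ⟨u + d, by rwa [sub_neg_eq_add] at h2, by rwa [add_sub_cancel_right]⟩

end LogVal

/-- Helly's theorem for order convex subsets of a linear order. -/
theorem helly_ordConnected {Γ ι : Type*} [LinearOrder Γ] [Nonempty Γ] [Finite ι] (C : ι → Set Γ)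
    (hC : ∀ i, (C i).OrdConnected) (h : ∀ i j, ∃ x, x ∈ C i ∧ x ∈ C j) : ∃ x, ∀ i, x ∈ C i := by
  rcases isEmpty_or_nonempty ι with hι | hι
  · exact ⟨Classical.arbitrary Γ, fun i => isEmptyElim i⟩
  choose x hx using h
  -- The common point is a max-min of the pairwise witnesses: take the least witness for each `i`,
  -- then the largest of these.
  have hmin : ∀ i, ∃ j, ∀ k, x i j ≤ x i k := fun i => Finite.exists_min (x i)
  choose m hm using hmin
  obtain ⟨i₀, hi₀⟩ := Finite.exists_max (fun i => x i (m i))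
  refine ⟨x i₀ (m i₀), fun i => (hC i).out (hx i (m i)).1 (hx i₀ i).2 ⟨hi₀ i, hm i₀ i⟩⟩

namespace LogVal

variable {Γ S : Type u} [AddCommGroup Γ] [LinearOrder Γ] [IsOrderedAddMonoid Γ]
  [LinearOrder S] [Module ℚ Γ] (V : LogVal Γ S)

theorem val_smul {q : ℚ} (hq : q ≠ 0) (a : Γ) : V.val (q • a) = V.val a := by
  have h1 : (q.den : ℤ) • (q • a) = q.num • a := by
    rw [← Int.cast_smul_eq_zsmul ℚ, ← Int.cast_smul_eq_zsmul ℚ, smul_smul, Int.cast_natCast,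
      Rat.den_mul_eq_num]
  rw [← V.val_zsmul q.den (q • a) (by exact_mod_cast q.den_nz), h1,
    V.val_zsmul _ _ (Rat.num_ne_zero.2 hq)]

theorem sign_rat_smul (q : ℚ) (a : Γ) :
    SignType.sign (q • a) = SignType.sign q * SignType.sign a := by
  have pos : ∀ (q : ℚ), 0 < q → ∀ a : Γ, SignType.sign (q • a) = SignType.sign a := by
    intro q hq a
    rcases lt_trichotomy a 0 with h | h | h
    · have := rat_smul_pos hq (neg_pos.2 h)
      rw [smul_neg, neg_pos] at this
      rw [sign_neg h, sign_neg this]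
    · simp [h]
    · rw [sign_pos h, sign_pos (rat_smul_pos hq h)]
  rcases lt_trichotomy q 0 with h | h | h
  · have := pos (-q) (neg_pos.2 h) a
    rw [neg_smul, Left.sign_neg] at this
    rw [sign_neg h, ← this]
    simp
  · simp [h]
  · rw [pos q h, sign_pos h, one_mul]

theorem sg_smul {q : ℚ} (hq : q ≠ 0) (a : Γ) (w : WithTop S) :
    V.sg (q • a) w = SignType.sign q * V.sg a w := by
  unfold sg
  rw [V.val_smul hq]
  split_ifs with h
  · simp
  · exact sign_rat_smul q a

/-- Here `u` lies between 0 and `d`, away from both ends; the midpoint `d / 2` works because scaling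
preserves values. -/
theorem exists_sg_one_neg_one (d : Γ) (w w' : WithTop S) :
    (∃ u, V.sg u w = 1 ∧ V.sg (u - d) w' = -1) ↔ V.sg d w = 1 ∧ V.sg d w' = 1 := by
  constructor
  · rintro ⟨u, h1, h2⟩
    have h3 := (V.sg_eq_neg_one.1 h2).1
    have h4 := (V.sg_eq_one.1 h1).1
    refine ⟨le_antisymm (SignType.le_one _) ?_, le_antisymm (SignType.le_one _) ?_⟩
    · rw [← h1]
      exact V.sg_mono w (sub_neg.1 h3).le
    · have h5 : V.sg (d - u) w' = 1 := by rw [← neg_sub, V.sg_neg, h2, neg_neg]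
      rw [← h5]
      exact V.sg_mono w' (sub_le_self d h4.le)
  · rintro ⟨h1, h2⟩
    refine ⟨(1 / 2 : ℚ) • d, by rw [V.sg_smul (by norm_num), h1, sign_pos (by norm_num)]; rfl, ?_⟩
    have e : (1 / 2 : ℚ) • d - d = (-(1 / 2) : ℚ) • d := by module
    rw [e, V.sg_smul (by norm_num), h2, sign_neg (by norm_num)]
    rfl

end LogVal

/-! ### Definability in the ordered set -/

/-- A condition on tuples is definable with parameters in the ordered set `S`. -/
def OrdDef {S : Type*} [LinearOrder S] {J : Type} (D : (J → S) → Prop) : Prop :=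
  letI := ltStructure S
  (Set.univ : Set S).Definable ltLanguage {z | D z}

namespace OrdDef

variable {S : Type*} [LinearOrder S] {J K : Type} {D D' : (J → S) → Prop}

theorem congr (h : OrdDef D) (e : ∀ z, D z ↔ D' z) : OrdDef D' := by
  have : D = D' := funext fun z => propext (e z)
  rwa [← this]

theorem not (h : OrdDef D) : OrdDef (fun z => ¬ D z) := by
  let _ := ltStructure S
  exact Set.Definable.compl h

theorem and (h : OrdDef D) (h' : OrdDef D') : OrdDef (fun z => D z ∧ D' z) := by
  let _ := ltStructure S
  exact Set.Definable.inter h h'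

theorem const (p : Prop) : OrdDef (fun _ : J → S => p) := by
  let _ := ltStructure S
  by_cases hp : p <;> simp [OrdDef, hp]

theorem reindex (h : OrdDef D) (e : J → K) : OrdDef (fun z : K → S => D (z ∘ e)) := by
  let _ := ltStructure S
  exact Set.Definable.preimage_comp e h

theorem exists_sum [Finite K] {D : (J ⊕ K → S) → Prop} (h : OrdDef D) :
    OrdDef (fun z => ∃ u, D (Sum.elim z u)) := by
  let _ := ltStructure S
  exact Set.Definable.exists_of_finite h

theorem lt (j k : J) : OrdDef (fun z : J → S => z j < z k) := by
  let _ := ltStructure S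
  have h : (∅ : Set S).Definable ltLanguage {z : J → S | z j < z k} := by
    let r : ltLanguage.Relations 2 := LtRel.lt
    refine (Set.empty_definable_iff (L := ltLanguage)).2
      ⟨r.formula₂ (Language.Term.var j) (Language.Term.var k), Set.ext fun z => ?_⟩
    exact (Language.Formula.realize_rel₂ (L := ltLanguage) (M := S) (R := r) (v := z)
      (t₁ := Language.Term.var j) (t₂ := Language.Term.var k)).symm
  exact h.mono (Set.empty_subset _)

theorem le (j k : J) : OrdDef (fun z : J → S => z j ≤ z k) :=
  (lt k j).not.congr fun _ => not_lt

theorem eq (j k : J) : OrdDef (fun z : J → S => z j = z k) :=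
  ((le j k).and (le k j)).congr fun _ => le_antisymm_iff.symm

theorem eq_const (j : J) (a : S) : OrdDef (fun z : J → S => z j = a) := by
  let _ := ltStructure S
  refine ⟨(Language.Term.var j).equal (ltLanguage.con (⟨a, trivial⟩ : (Set.univ : Set S))).term, ?_⟩
  ext z
  simp

theorem exists_between (j k : J) : OrdDef (fun z : J → S => ∃ u, z j < u ∧ u < z k) := by
  have h := exists_sum (K := Unit)
    ((lt (S := S) (Sum.inl j : J ⊕ Unit) (Sum.inr ())).and (lt (Sum.inr ()) (Sum.inl k)))
  refine h.congr fun z => ⟨?_, ?_⟩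
  · rintro ⟨u, hu⟩
    exact ⟨u (), hu⟩
  · rintro ⟨u, hu⟩
    exact ⟨fun _ => u, hu⟩

theorem all {ι : Type*} [Finite ι] {E : ι → (J → S) → Prop} (h : ∀ i, OrdDef (E i)) :
    OrdDef (fun z => ∀ i, E i z) := by
  let _ := ltStructure S
  have := Set.definable_iInter_of_finite h
  unfold OrdDef
  convert this using 1
  ext z
  simp

end OrdDef

namespace LogVal

variable {X Γ S : Type u} [AddCommGroup Γ] [LinearOrder Γ] [IsOrderedAddMonoid Γ]
  [LinearOrder S] (V : LogVal Γ S)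

/-- The value of a threshold: `∞`, a coordinate, or the successor of a coordinate. -/
def ev {J : Type} : Option (J × Bool) → (J → S) → WithTop S
  | none, _ => ⊤
  | some (j, false), z => z j
  | some (j, true), z => V.sc (z j)

theorem ev_map {J K : Type} (e : J → K) (o : Option (J × Bool)) (z : K → S) :
    V.ev (o.map (Prod.map e id)) z = V.ev o (z ∘ e) := by
  rcases o with _ | ⟨j, _ | _⟩ <;> rfl

/-- The successor is expressible by the order: `z < sc w` means `z ≤ w`, and `sc z < w` means that
some element lies strictly between. -/
theorem ordDef_ev_lt {J : Type} (o o' : Option (J × Bool)) :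
    OrdDef (fun z : J → S => V.ev o z < V.ev o' z) := by
  rcases o with _ | ⟨j, _ | _⟩
  · exact (OrdDef.const False).congr fun z => by simp [ev]
  · rcases o' with _ | ⟨k, _ | _⟩
    · exact (OrdDef.const True).congr fun z => by simp [ev]
    · exact (OrdDef.lt j k).congr fun z => by simp [ev]
    · refine (OrdDef.le j k).congr fun z => ?_
      simp only [ev, WithTop.coe_lt_coe]
      exact V.lt_sc_iff.symm
  · rcases o' with _ | ⟨k, _ | _⟩
    · exact (OrdDef.const True).congr fun z => by simp [ev]
    · refine (OrdDef.exists_between j k).congr fun z => ?_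
      simp only [ev, WithTop.coe_lt_coe]
      constructor
      · rintro ⟨u, h1, h2⟩
        exact ((V.sc_le _ _).2 h1).trans_lt h2
      · exact fun h => ⟨_, V.lt_sc _, h⟩
    · refine (OrdDef.lt j k).congr fun z => ?_
      simp only [ev, WithTop.coe_lt_coe]
      exact V.sc_lt_sc.symm

theorem ordDef_exists_lt_ev {J : Type} (o o' : Option (J × Bool)) :
    OrdDef (fun z : J → S => ∃ s : S, (s : WithTop S) < V.ev o z ∧
      (s : WithTop S) < V.ev o' z) := by
  have h := OrdDef.exists_sum (K := Unit)
    ((V.ordDef_ev_lt (some (Sum.inr (), false)) (o.map (Prod.map (Sum.inl : J → J ⊕ Unit) id))).and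
      (V.ordDef_ev_lt (some (Sum.inr (), false)) (o'.map (Prod.map Sum.inl id))))
  refine h.congr fun z => ?_
  simp only [V.ev_map, Sum.elim_comp_inl]
  constructor
  · rintro ⟨u, hu⟩
    exact ⟨u (), hu⟩
  · rintro ⟨u, hu⟩
    exact ⟨fun _ => u, hu⟩

theorem ordDef_sc {J : Type} (j k : J) : OrdDef (fun z : J → S => z k = V.sc (z j)) := by
  refine ((V.ordDef_ev_lt (some (j, true)) (some (k, false))).not.and
    (V.ordDef_ev_lt (some (k, false)) (some (j, true))).not).congr fun z => ?_
  simp only [ev, WithTop.coe_lt_coe, not_lt]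
  exact le_antisymm_iff.symm

variable [Module ℚ Γ]

/-! ### Linear functions -/

/-- Adjoin the embedded coordinates of a tuple of elements of `S` to a space of functions. -/
def lin (Λ : Submodule ℚ (X → Γ)) (J : Type) [Fintype J] : Submodule ℚ (X × (J → S) → Γ) where
  carrier := {f | ∃ l ∈ Λ, ∃ c : J → ℚ, ∀ p, f p = l p.1 + ∑ j, c j • V.emb (p.2 j)}
  zero_mem' := ⟨0, Λ.zero_mem, 0, fun p => by simp⟩
  add_mem' := by
    rintro f g ⟨l, hl, c, hf⟩ ⟨m, hm, d, hg⟩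
    refine ⟨l + m, Λ.add_mem hl hm, c + d, fun p => ?_⟩
    simp only [Pi.add_apply, hf, hg, add_smul, Finset.sum_add_distrib]
    abel
  smul_mem' := by
    rintro q f ⟨l, hl, c, hf⟩
    refine ⟨q • l, Λ.smul_mem q hl, q • c, fun p => ?_⟩
    simp only [Pi.smul_apply, hf, smul_add, Finset.smul_sum, smul_smul, smul_eq_mul]

/-- Adjoin a variable ranging over `Γ` to a space of functions. -/
def adj (Λ : Submodule ℚ (X → Γ)) : Submodule ℚ (X × Γ → Γ) where
  carrier := {f | ∃ l ∈ Λ, ∃ q : ℚ, ∀ p, f p = l p.1 + q • p.2}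
  zero_mem' := ⟨0, Λ.zero_mem, 0, fun p => by simp⟩
  add_mem' := by
    rintro f g ⟨l, hl, c, hf⟩ ⟨m, hm, d, hg⟩
    refine ⟨l + m, Λ.add_mem hl hm, c + d, fun p => ?_⟩
    simp only [Pi.add_apply, hf, hg, add_smul]
    abel
  smul_mem' := by
    rintro q f ⟨l, hl, c, hf⟩
    refine ⟨q • l, Λ.smul_mem q hl, q • c, fun p => ?_⟩
    simp only [Pi.smul_apply, hf, smul_add, smul_smul, smul_eq_mul]

variable {Λ : Submodule ℚ (X → Γ)} {J K : Type} [Fintype J] [Fintype K]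

theorem fst_mem_lin {l : X → Γ} (hl : l ∈ Λ) : (fun p => l p.1) ∈ V.lin Λ J :=
  ⟨l, hl, 0, fun p => by simp⟩

theorem coord_mem_lin (j : J) : (fun p => V.emb (p.2 j)) ∈ V.lin Λ J := by
  classical
  refine ⟨0, Λ.zero_mem, Pi.single j 1, fun p => ?_⟩
  rw [Finset.sum_eq_single j]
  · simp
  · intro k _ hk
    simp [hk]
  · simp

theorem lin_mem_lin {Y : Type u} {Λ' : Submodule ℚ (Y → Γ)} {f : X × (J → S) → Γ}
    (hf : f ∈ V.lin Λ J)
    (π : Y → X × (J → S)) (h1 : ∀ l ∈ Λ, (fun y => l (π y).1) ∈ Λ')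
    (h2 : ∀ j, (fun y => V.emb ((π y).2 j)) ∈ Λ') : (fun y => f (π y)) ∈ Λ' := by
  obtain ⟨l, hl, c, hf⟩ := hf
  have e : (fun y => f (π y)) =
      (fun y => l (π y).1) + ∑ j, c j • (fun y => V.emb ((π y).2 j)) := by
    funext y
    simp [hf]
  rw [e]
  exact Λ'.add_mem (h1 l hl) (Λ'.sum_mem fun j _ => Λ'.smul_mem _ (h2 j))

/-- `f` is a linear function of `x` and the embedded coordinates of `z`. -/
def Tame (Λ : Submodule ℚ (X → Γ)) (f : X → (J → S) → Γ) : Prop :=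
  (fun p : X × (J → S) => f p.1 p.2) ∈ V.lin Λ J

namespace Tame

variable {V} {f g : X → (J → S) → Γ}

theorem of_mem {l : X → Γ} (hl : l ∈ Λ) : V.Tame Λ (fun x (_ : J → S) => l x) :=
  V.fst_mem_lin hl

theorem coord (j : J) : V.Tame Λ (fun _ (z : J → S) => V.emb (z j)) := V.coord_mem_lin j

theorem zero : V.Tame Λ (fun _ (_ : J → S) => 0) := (V.lin Λ J).zero_mem

theorem add (hf : V.Tame Λ f) (hg : V.Tame Λ g) : V.Tame Λ (fun x z => f x z + g x z) :=
  (V.lin Λ J).add_mem hf hg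

theorem sub (hf : V.Tame Λ f) (hg : V.Tame Λ g) : V.Tame Λ (fun x z => f x z - g x z) :=
  (V.lin Λ J).sub_mem hf hg

theorem neg (hf : V.Tame Λ f) : V.Tame Λ (fun x z => - f x z) :=
  (V.lin Λ J).neg_mem hf

theorem smul (q : ℚ) (hf : V.Tame Λ f) : V.Tame Λ (fun x z => q • f x z) :=
  (V.lin Λ J).smul_mem q hf

theorem reindex (hf : V.Tame Λ f) (e : J → K) : V.Tame Λ (fun x (z : K → S) => f x (z ∘ e)) :=
  V.lin_mem_lin hf (fun p : X × (K → S) => (p.1, p.2 ∘ e)) (fun _ hl => V.fst_mem_lin hl)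
    (fun j => V.coord_mem_lin (e j))

/-- Elements of `S` absorbed into the base space can be turned back into coordinates. -/
theorem uncurry {f : X × (K → S) → (J → S) → Γ} (hf : V.Tame (V.lin Λ K) f) :
    V.Tame Λ (fun x (z : K ⊕ J → S) => f (x, z ∘ Sum.inl) (z ∘ Sum.inr)) :=
  V.lin_mem_lin hf (fun p : X × (K ⊕ J → S) => ((p.1, p.2 ∘ Sum.inl), p.2 ∘ Sum.inr))
    (fun _ hl => V.lin_mem_lin hl (fun p : X × (K ⊕ J → S) => (p.1, p.2 ∘ Sum.inl))
      (fun _ hl => V.fst_mem_lin hl)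
      (fun k => V.coord_mem_lin (Sum.inl k)))
    (fun j => V.coord_mem_lin (Sum.inr j))

theorem adj (hf : V.Tame Λ f) : V.Tame (adj Λ) (fun p z => f p.1 z) := by
  obtain ⟨l, hl, c, hf⟩ := hf
  exact ⟨fun p => l p.1, ⟨l, hl, 0, fun p => by simp⟩, c, fun p => hf (p.1.1, p.2)⟩

theorem snd : V.Tame (LogVal.adj Λ) (fun p (_ : J → S) => p.2) :=
  ⟨fun p => p.2, ⟨0, Λ.zero_mem, 1, fun p => by simp⟩, 0, fun p => by simp⟩

theorem split_adj {f : X × Γ → (J → S) → Γ} (hf : V.Tame (LogVal.adj Λ) f) :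
    ∃ (g : X → (J → S) → Γ) (q : ℚ), V.Tame Λ g ∧ ∀ x y z, f (x, y) z = g x z + q • y := by
  obtain ⟨_, ⟨l, hl, q, h⟩, c, hf⟩ := hf
  refine ⟨fun x z => l x + ∑ j, c j • V.emb (z j), q, ⟨l, hl, c, fun p => rfl⟩, fun x y z => ?_⟩
  have := hf ((x, y), z)
  dsimp only at this
  rw [this, h]
  dsimp only
  abel

end Tame

end LogVal

namespace LogVal

variable {X Γ S : Type u} [AddCommGroup Γ] [LinearOrder Γ] [IsOrderedAddMonoid Γ]
  [LinearOrder S] [Module ℚ Γ] (V : LogVal Γ S)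
  {Λ : Submodule ℚ (X → Γ)} {J K : Type} [Fintype J] [Fintype K]

/-! ### Quantifier-free relations and elimination of quantifiers over the group -/

/-- Quantifier-free relations between `x` and a tuple `z` of elements of `S`. -/
inductive QF (Λ : Submodule ℚ (X → Γ)) {J : Type} [Fintype J] : (X → (J → S) → Prop) → Prop
  | ord {D : (J → S) → Prop} (h : OrdDef D) : QF Λ (fun _ z => D z)
  | atom {f : X → (J → S) → Γ} (hf : V.Tame Λ f) (o : Option (J × Bool)) (e : SignType) :
      QF Λ (fun x z => V.sg (f x z) (V.ev o z) = e)
  | not {R : X → (J → S) → Prop} (h : QF Λ R) : QF Λ (fun x z => ¬ R x z)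
  | and {R R' : X → (J → S) → Prop} (h : QF Λ R) (h' : QF Λ R') : QF Λ (fun x z => R x z ∧ R' x z)

namespace QF

variable {V} {R R' : X → (J → S) → Prop}

theorem congr (h : V.QF Λ R) (e : ∀ x z, R x z ↔ R' x z) : V.QF Λ R' := by
  have : R = R' := funext fun x => funext fun z => propext (e x z)
  rwa [← this]

theorem or (h : V.QF Λ R) (h' : V.QF Λ R') : V.QF Λ (fun x z => R x z ∨ R' x z) :=
  (h.not.and h'.not).not.congr fun x z => by tauto

theorem imp (h : V.QF Λ R) (h' : V.QF Λ R') : V.QF Λ (fun x z => R x z → R' x z) :=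
  (h.and h'.not).not.congr fun x z => by tauto

theorem const (p : Prop) : V.QF Λ (fun _ (_ : J → S) => p) := .ord (OrdDef.const p)

theorem all {ι : Type} [Finite ι] {R : ι → X → (J → S) → Prop} (h : ∀ i, V.QF Λ (R i)) :
    V.QF Λ (fun x z => ∀ i, R i x z) := by
  classical
  have := Fintype.ofFinite ι
  have key : ∀ s : Finset ι, V.QF Λ (fun x z => ∀ i ∈ s, R i x z) := by
    intro s
    induction s using Finset.induction_on with
    | empty => exact (const True).congr fun x z => by simp
    | insert i s _ ih => exact ((h i).and ih).congr fun x z => by simp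
  exact (key Finset.univ).congr fun x z => by simp

theorem ex {ι : Type} [Finite ι] {R : ι → X → (J → S) → Prop} (h : ∀ i, V.QF Λ (R i)) :
    V.QF Λ (fun x z => ∃ i, R i x z) :=
  (all fun i => (h i).not).not.congr fun x z => by simp

theorem reindex (h : V.QF Λ R) (e : J → K) : V.QF Λ (fun x (z : K → S) => R x (z ∘ e)) := by
  induction h with
  | ord h => exact .ord (h.reindex e)
  | atom hf o s =>
    exact (QF.atom (hf.reindex e) (o.map (Prod.map e id)) s).congr fun x z => by rw [V.ev_map]
  | not _ ih => exact ih.not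
  | and _ _ ih ih' => exact ih.and ih'

theorem uncurry {R : X × (K → S) → (J → S) → Prop} (h : V.QF (V.lin Λ K) R) :
    V.QF Λ (fun x (z : K ⊕ J → S) => R (x, z ∘ Sum.inl) (z ∘ Sum.inr)) := by
  induction h with
  | ord h => exact .ord (h.reindex Sum.inr)
  | atom hf o s =>
    exact (QF.atom hf.uncurry (o.map (Prod.map Sum.inr id)) s).congr fun x z => by rw [V.ev_map]
  | not _ ih => exact ih.not
  | and _ _ ih ih' => exact ih.and ih'

theorem eq_zero {f : X → (J → S) → Γ} (hf : V.Tame Λ f) : V.QF Λ (fun x z => f x z = 0) :=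
  (QF.atom hf none 0).congr fun x z => by
    rw [V.sg_eq_zero]
    simp only [ev, top_le_iff]
    exact V.val_eq_top _

theorem eq {f g : X → (J → S) → Γ} (hf : V.Tame Λ f) (hg : V.Tame Λ g) :
    V.QF Λ (fun x z => f x z = g x z) :=
  (eq_zero (hf.sub hg)).congr fun _ _ => sub_eq_zero

theorem pos {f : X → (J → S) → Γ} (hf : V.Tame Λ f) : V.QF Λ (fun x z => 0 < f x z) :=
  (QF.atom hf none 1).congr fun x z => by
    simp only [ev, V.sg_top]
    exact sign_eq_one_iff

theorem val_eq {f : X → (J → S) → Γ} (hf : V.Tame Λ f) (j : J) :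
    V.QF Λ (fun x z => V.val (f x z) = z j) :=
  ((QF.atom hf (some (j, false)) 0).and (QF.atom hf (some (j, true)) 0).not).congr
    fun _ _ => V.val_eq_coe_iff.symm

/-- All dependence on `x` passes through a finite sign vector, so an existential quantifier over the
group becomes a finite disjunction over sign vectors. -/
theorem exists_normal_form (h : V.QF Λ R) :
    ∃ (ι : Type) (_ : Fintype ι) (f : ι → X → (J → S) → Γ) (o : ι → Option (J × Bool))
      (D : (ι → SignType) → (J → S) → Prop), (∀ i, V.Tame Λ (f i)) ∧ (∀ e, OrdDef (D e)) ∧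
      ∀ x z, R x z ↔ D (fun i => V.sg (f i x z) (V.ev (o i) z)) z := by
  induction h with
  | @ord D h =>
    exact ⟨Empty, inferInstance, fun i => i.elim, fun i => i.elim, fun _ => D, fun i => i.elim,
      fun _ => h, fun _ _ => Iff.rfl⟩
  | @atom f hf o s =>
    exact ⟨Unit, inferInstance, fun _ => f, fun _ => o, fun e _ => e () = s, fun _ => hf,
      fun _ => OrdDef.const _, fun _ _ => Iff.rfl⟩
  | not _ ih =>
    obtain ⟨ι, hι, f, o, D, hf, hD, h⟩ := ih
    exact ⟨ι, hι, f, o, fun e z => ¬ D e z, hf, fun e => (hD e).not, fun x z => not_congr (h x z)⟩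
  | and _ _ ih ih' =>
    obtain ⟨ι, hι, f, o, D, hf, hD, h⟩ := ih
    obtain ⟨ι', hι', f', o', D', hf', hD', h'⟩ := ih'
    refine ⟨ι ⊕ ι', inferInstance, Sum.elim f f', Sum.elim o o',
      fun e z => D (e ∘ Sum.inl) z ∧ D' (e ∘ Sum.inr) z, ?_, fun e => (hD _).and (hD' _),
      fun x z => and_congr (h x z) (h' x z)⟩
    rintro (i | i)
    · exact hf i
    · exact hf' i

theorem exists_sg_sub {f : X → (J → S) → Γ} (hf : V.Tame Λ f) (o o' : Option (J × Bool))
    (e e' : SignType) :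
    V.QF Λ (fun x z => ∃ u, V.sg u (V.ev o z) = e ∧ V.sg (u - f x z) (V.ev o' z) = e') := by
  have h11 : V.QF Λ (fun x z => ∃ u, V.sg u (V.ev o z) = 1 ∧ V.sg (u - f x z) (V.ev o' z) = 1) :=
    (QF.ord (V.ordDef_exists_lt_ev o o')).congr fun x z => (V.exists_sg_one_one _ _ _).symm
  have h00 : V.QF Λ (fun x z => ∃ u, V.sg u (V.ev o z) = 0 ∧ V.sg (u - f x z) (V.ev o' z) = 0) :=
    ((QF.atom hf o 0).or (QF.atom hf o' 0)).congr fun x z => (V.exists_sg_zero_zero _ _ _).symm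
  have h01 : ∀ {f : X → (J → S) → Γ} (_ : V.Tame Λ f) (o o' : Option (J × Bool)), V.QF Λ
      (fun x z => ∃ u, V.sg u (V.ev o z) = 0 ∧ V.sg (u - f x z) (V.ev o' z) = 1) :=
    fun hf o o' => ((QF.atom hf o' (-1)).or ((QF.ord (V.ordDef_ev_lt o o')).and
      (QF.atom hf o 0))).congr fun x z => (V.exists_sg_zero_one _ _ _).symm
  have h1n : ∀ {f : X → (J → S) → Γ} (_ : V.Tame Λ f) (o o' : Option (J × Bool)), V.QF Λ
      (fun x z => ∃ u, V.sg u (V.ev o z) = 1 ∧ V.sg (u - f x z) (V.ev o' z) = -1) :=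
    fun hf o o' => ((QF.atom hf o 1).and (QF.atom hf o' 1)).congr
      fun x z => (V.exists_sg_one_neg_one _ _ _).symm
  -- The cases run through the signs in the order 0, -1, 1; reflection and swapping bring each to
  -- one of the four forms above.
  rcases e with _ | _ | _ <;> rcases e' with _ | _ | _
  · exact h00
  · exact (h01 hf.neg o o').congr fun x z => (V.exists_sg_neg 0 (-1) _ _ _).symm
  · exact h01 hf o o'
  · exact (h01 hf o' o).congr fun x z => by
      rw [V.exists_sg_swap, V.exists_sg_neg, neg_neg]
      rfl
  · exact (QF.ord (V.ordDef_exists_lt_ev o o')).congr fun x z => by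
      rw [← V.exists_sg_one_one (-f x z), V.exists_sg_neg, neg_neg]
      rfl
  · exact (h1n hf.neg o o').congr fun x z => (V.exists_sg_neg (-1) 1 _ _ _).symm
  · exact (h01 hf.neg o' o).congr fun x z => (V.exists_sg_swap 1 0 _ _ _).symm
  · exact h1n hf o o'
  · exact h11

/-- Dividing by nonzero coefficients and translating `y` puts the two conditions in the form of
`exists_sg_sub`; a zero coefficient makes its condition independent of `y`. -/
theorem exists_sg_add_smul {f f' : X → (J → S) → Γ} (hf : V.Tame Λ f) (hf' : V.Tame Λ f')
    (q q' : ℚ) (o o' : Option (J × Bool)) (e e' : SignType) :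
    V.QF Λ (fun x z => ∃ y, V.sg (f x z + q • y) (V.ev o z) = e ∧
      V.sg (f' x z + q' • y) (V.ev o' z) = e') := by
  have main : ∀ {f f' : X → (J → S) → Γ} (_ : V.Tame Λ f) (_ : V.Tame Λ f')
      (q q' : ℚ) (_ : q ≠ 0) (_ : q' ≠ 0) (o o' : Option (J × Bool)) (e e' : SignType),
      V.QF Λ (fun x z => ∃ y, V.sg (f x z + q • y) (V.ev o z) = e ∧
        V.sg (f' x z + q' • y) (V.ev o' z) = e') := by
    intro f f' hf hf' q q' hq hq' o o' e e'
    have hs : ∀ (q : ℚ) (_ : q ≠ 0) (a : Γ) (w : WithTop S) (e : SignType),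
        V.sg (q • a) w = e ↔ V.sg a w = SignType.sign q * e := by
      intro q hq a w e
      rw [V.sg_smul hq]
      generalize V.sg a w = s
      rcases lt_or_gt_of_ne hq with h | h
      · rw [sign_neg h]
        revert s e
        decide
      · rw [sign_pos h]
        revert s e
        decide
    refine (exists_sg_sub ((hf.smul q⁻¹).sub (hf'.smul q'⁻¹)) o o' (SignType.sign q * e)
      (SignType.sign q' * e')).congr fun x z => ?_
    have h1 : ∀ y, f x z + q • y = q • (y + q⁻¹ • f x z) := fun y => by
      rw [smul_add, smul_inv_smul₀ hq, add_comm]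
    have h2 : ∀ y, f' x z + q' • y =
        q' • ((y + q⁻¹ • f x z) - (q⁻¹ • f x z - q'⁻¹ • f' x z)) := fun y => by
      rw [sub_sub_eq_add_sub, add_right_comm, add_sub_cancel_right, smul_add, smul_inv_smul₀ hq',
        add_comm]
    constructor
    · rintro ⟨u, h3, h4⟩
      refine ⟨u - q⁻¹ • f x z, ?_, ?_⟩
      · rw [h1, hs q hq, sub_add_cancel, h3]
      · rw [h2, hs q' hq', sub_add_cancel, h4]
    · rintro ⟨y, h3, h4⟩
      exact ⟨y + q⁻¹ • f x z, by rwa [h1, hs q hq] at h3, by rwa [h2, hs q' hq'] at h4⟩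
  have single : ∀ {f : X → (J → S) → Γ} (_ : V.Tame Λ f) (q : ℚ) (o : Option (J × Bool))
      (e : SignType), V.QF Λ (fun x z => ∃ y, V.sg (f x z + q • y) (V.ev o z) = e) := by
    intro f hf q o e
    by_cases hq : q = 0
    · exact (QF.atom hf o e).congr fun x z => by simp [hq]
    · exact (main hf hf q q hq hq o o e e).congr fun x z => by simp
  by_cases hq : q = 0
  · exact ((QF.atom hf o e).and (single hf' q' o' e')).congr fun x z => by simp [hq]
  by_cases hq' : q' = 0
  · exact ((single hf q o e).and (QF.atom hf' o' e')).congr fun x z => by simp [hq']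
  exact main hf hf' q q' hq hq' o o' e e'

/-- For a fixed sign vector each condition defines a convex set of `y`, so by `helly_ordConnected`
it suffices that every two conditions have a common solution. -/
theorem exists_adj {R : X × Γ → (J → S) → Prop} (h : V.QF (adj Λ) R) :
    V.QF Λ (fun x z => ∃ y, R (x, y) z) := by
  obtain ⟨ι, _, f, o, D, hf, hD, hR⟩ := h.exists_normal_form
  choose g q hg hfg using fun i => (hf i).split_adj
  refine (QF.ex fun e : ι → SignType => (QF.ord (hD e)).and (QF.all fun i : ι => QF.all fun j : ι =>
    exists_sg_add_smul (hg i) (hg j) (q i) (q j) (o i) (o j) (e i) (e j))).congr fun x z => ?_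
  simp only [hR, hfg]
  constructor
  · rintro ⟨e, h1, h2⟩
    have hC : ∀ i, {y | V.sg (g i x z + q i • y) (V.ev (o i) z) = e i}.OrdConnected := by
      intro i
      rcases lt_trichotomy (q i) 0 with hq | hq | hq
      · refine ⟨fun a ha b hb c hc => ?_⟩
        have m := V.ordConnected_sg (g i x z) (V.ev (o i) z) (e i)
        have h3 : ∀ {u v : Γ}, u ≤ v → q i • v ≤ q i • u := fun {u v} huv => by
          rcases huv.eq_or_lt with h | h
          · rw [h]
          · have := rat_smul_pos (neg_pos.2 hq) (sub_pos.2 h)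
            rw [neg_smul, neg_pos, smul_sub, sub_neg] at this
            exact this.le
        have := m.out (x := q i • b) (y := q i • a) (by simpa [add_comm] using hb)
          (by simpa [add_comm] using ha) ⟨h3 hc.2, h3 hc.1⟩
        simpa [add_comm] using this
      · refine ⟨fun a ha b hb c hc => ?_⟩
        simpa [hq] using ha
      · refine ⟨fun a ha b hb c hc => ?_⟩
        have m := V.ordConnected_sg (g i x z) (V.ev (o i) z) (e i)
        have h3 : ∀ {u v : Γ}, u ≤ v → q i • u ≤ q i • v := fun {u v} huv => by
          rcases huv.eq_or_lt with h | h
          · rw [h]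
          · have := rat_smul_pos hq (sub_pos.2 h)
            rw [smul_sub, sub_pos] at this
            exact this.le
        have := m.out (x := q i • a) (y := q i • b) (by simpa [add_comm] using ha)
          (by simpa [add_comm] using hb) ⟨h3 hc.1, h3 hc.2⟩
        simpa [add_comm] using this
    obtain ⟨y, hy⟩ := helly_ordConnected _ hC h2
    refine ⟨y, ?_⟩
    have : (fun i => V.sg (g i x z + q i • y) (V.ev (o i) z)) = e := funext hy
    rwa [this]
  · rintro ⟨y, hy⟩
    exact ⟨_, hy, fun i j => ⟨y, rfl, rfl⟩⟩

end QF

end LogVal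

namespace LogVal

variable {X Γ S : Type u} [AddCommGroup Γ] [LinearOrder Γ] [IsOrderedAddMonoid Γ]
  [LinearOrder S] [Module ℚ Γ] (V : LogVal Γ S)
  {Λ : Submodule ℚ (X → Γ)} {J J' K : Type} [Fintype K]

/-! ### Relations with uniformly order-definable fibers -/

/-- The fibers `{y | R x y}` are defined in the ordered set `S` by a single formula whose
parameters depend on `x` in a quantifier-free way. -/
def Fib (Λ : Submodule ℚ (X → Γ)) {J : Type} (R : X → (J → S) → Prop) : Prop :=
  ∃ (K : Type) (_ : Fintype K) (L : X → (K → S) → Prop) (D : (K ⊕ J → S) → Prop),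
    V.QF Λ L ∧ OrdDef D ∧ (∀ x, ∃ z, L x z) ∧
      ∀ x z y, L x z → (R x y ↔ D (Sum.elim z y))

namespace Fib

variable {V} {R R' : X → (J → S) → Prop}

theorem congr (h : V.Fib Λ R) (e : ∀ x z, R x z ↔ R' x z) : V.Fib Λ R' := by
  have : R = R' := funext fun x => funext fun z => propext (e x z)
  rwa [← this]

theorem ord {D : (J → S) → Prop} (h : OrdDef D) : V.Fib Λ (fun _ y => D y) :=
  ⟨Empty, inferInstance, fun _ _ => True, fun z => D (z ∘ Sum.inr), QF.const True,
    h.reindex Sum.inr, fun _ => ⟨fun k => k.elim, trivial⟩, fun _ _ _ _ => Iff.rfl⟩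

theorem const (p : Prop) : V.Fib Λ (fun _ (_ : J → S) => p) := ord (OrdDef.const p)

theorem not (h : V.Fib Λ R) : V.Fib Λ (fun x y => ¬ R x y) := by
  obtain ⟨K, hK, L, D, hL, hD, ht, h⟩ := h
  exact ⟨K, hK, L, fun z => ¬ D z, hL, hD.not, ht, fun x z y hz => not_congr (h x z y hz)⟩

theorem and (h : V.Fib Λ R) (h' : V.Fib Λ R') : V.Fib Λ (fun x y => R x y ∧ R' x y) := by
  obtain ⟨K, hK, L, D, hL, hD, ht, h⟩ := h
  obtain ⟨K', hK', L', D', hL', hD', ht', h'⟩ := h'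
  refine ⟨K ⊕ K', inferInstance, fun x z => L x (z ∘ Sum.inl) ∧ L' x (z ∘ Sum.inr),
    fun z => D (z ∘ Sum.map Sum.inl id) ∧ D' (z ∘ Sum.map Sum.inr id),
    (hL.reindex _).and (hL'.reindex _), (hD.reindex _).and (hD'.reindex _), fun x => ?_, ?_⟩
  · obtain ⟨z, hz⟩ := ht x
    obtain ⟨z', hz'⟩ := ht' x
    exact ⟨Sum.elim z z', hz, hz'⟩
  · intro x z y ⟨hz, hz'⟩
    beta_reduce
    rw [h x _ y hz, h' x _ y hz', Sum.elim_comp_map, Sum.elim_comp_map]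
    rfl

theorem or (h : V.Fib Λ R) (h' : V.Fib Λ R') : V.Fib Λ (fun x y => R x y ∨ R' x y) :=
  (h.not.and h'.not).not.congr fun x y => by tauto

theorem imp (h : V.Fib Λ R) (h' : V.Fib Λ R') : V.Fib Λ (fun x y => R x y → R' x y) :=
  (h.and h'.not).not.congr fun x y => by tauto

theorem all {ι : Type} [Finite ι] {R : ι → X → (J → S) → Prop} (h : ∀ i, V.Fib Λ (R i)) :
    V.Fib Λ (fun x y => ∀ i, R i x y) := by
  classical
  have := Fintype.ofFinite ι
  have key : ∀ s : Finset ι, V.Fib Λ (fun x y => ∀ i ∈ s, R i x y) := by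
    intro s
    induction s using Finset.induction_on with
    | empty => exact (const True).congr fun x y => by simp
    | insert i s _ ih => exact ((h i).and ih).congr fun x y => by simp
  exact (key Finset.univ).congr fun x y => by simp

theorem ex {ι : Type} [Finite ι] {R : ι → X → (J → S) → Prop} (h : ∀ i, V.Fib Λ (R i)) :
    V.Fib Λ (fun x y => ∃ i, R i x y) :=
  (all fun i => (h i).not).not.congr fun x y => by simp

theorem reindex (h : V.Fib Λ R) (e : J → J') : V.Fib Λ (fun x (y : J' → S) => R x (y ∘ e)) := by
  obtain ⟨M, hM, L, D, hL, hD, ht, h⟩ := h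
  refine ⟨M, hM, L, fun z => D (z ∘ Sum.map id e), hL, hD.reindex _, ht, fun x z y hz => ?_⟩
  beta_reduce
  rw [h x z _ hz, Sum.elim_comp_map]
  rfl

theorem exists_sum {R : X → (J ⊕ K → S) → Prop} (h : V.Fib Λ R) :
    V.Fib Λ (fun x y => ∃ u, R x (Sum.elim y u)) := by
  obtain ⟨M, hM, L, D, hL, hD, ht, h⟩ := h
  refine ⟨M, hM, L, _, hL, (hD.reindex (Equiv.sumAssoc M J K).symm).exists_sum, ht,
    fun x z y hz => exists_congr fun u => ?_⟩
  rw [h x z _ hz]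
  refine iff_of_eq (congrArg D (funext fun i => ?_))
  rcases i with i | i | i <;> rfl

/-- A truth value is coded by whether two parameters coincide; distinct ones exist since every
element of `S` has a successor. -/
theorem of_prop {P : X → Prop} (h : V.QF Λ (fun x (_ : Empty → S) => P x)) :
    V.Fib Λ (fun x (_ : J → S) => P x) := by
  refine ⟨Bool, inferInstance, fun x z => P x ↔ z true = z false,
    fun z => z (Sum.inl true) = z (Sum.inl false), ?_, OrdDef.eq _ _, fun x => ?_,
    fun x z y h => h⟩
  · have h1 : V.QF Λ (fun x (_ : Bool → S) => P x) := h.reindex Empty.elim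
    have h2 : V.QF Λ (fun _ (z : Bool → S) => z true = z false) := .ord (OrdDef.eq _ _)
    exact ((h1.imp h2).and (h2.imp h1)).congr fun x z => by tauto
  · by_cases hx : P x
    · exact ⟨fun _ => V.int 0, by simp [hx]⟩
    · exact ⟨fun b => if b then V.int 0 else V.sc (V.int 0), by simp [hx, (V.lt_sc _).ne]⟩

/-- A relation may be given only above the points of `X` that satisfy a given condition. -/
theorem of_on {P : X → Prop} (hP : V.Fib Λ (fun x (_ : Empty → S) => P x))
    {L : X → (K → S) → Prop} {D : (K ⊕ J → S) → Prop} (hL : V.QF Λ L) (hD : OrdDef D)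
    (ht : ∀ x, P x → ∃ z, L x z) (hn : ∀ x y, R x y → P x)
    (h : ∀ x z y, P x → L x z → (R x y ↔ D (Sum.elim z y))) : V.Fib Λ R := by
  obtain ⟨M, hM, LP, DP, hLP, hDP, htP, hP⟩ := hP
  -- The `M`-parameters already reveal whether `P x` holds, so `L` is imposed only in that case.
  -- Elsewhere the `K`-parameters are arbitrary, and parameters exist over every `x`.
  refine ⟨M ⊕ K, inferInstance, fun x z => LP x (z ∘ Sum.inl) ∧
      (DP (z ∘ Sum.elim Sum.inl Empty.elim) → L x (z ∘ Sum.inr)),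
    fun z => DP (z ∘ Sum.elim (Sum.inl ∘ Sum.inl) Empty.elim) ∧ D (z ∘ Sum.map Sum.inr id),
    (hLP.reindex _).and ((QF.ord (hDP.reindex _)).imp (hL.reindex _)),
    (hDP.reindex _).and (hD.reindex _), fun x => ?_, ?_⟩
  · obtain ⟨z, hz⟩ := htP x
    have e : ∀ z' : K → S, Sum.elim z z' ∘ Sum.elim Sum.inl Empty.elim = Sum.elim z Empty.elim := by
      intro z'
      funext i
      rcases i with i | i
      · rfl
      · exact i.elim
    by_cases hx : P x
    · obtain ⟨z', hz'⟩ := ht x hx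
      exact ⟨Sum.elim z z', hz, fun _ => hz'⟩
    · refine ⟨Sum.elim z fun _ => V.int 0, hz, fun h' => absurd ?_ hx⟩
      rw [e] at h'
      exact (hP x z _ hz).2 h'
  · intro x z y ⟨hz, hz'⟩
    beta_reduce
    have e : Sum.elim z y ∘ Sum.elim (Sum.inl ∘ Sum.inl) Empty.elim =
        Sum.elim (z ∘ Sum.inl) Empty.elim := by
      funext i
      rcases i with i | i
      · rfl
      · exact i.elim
    have e' : z ∘ Sum.elim Sum.inl Empty.elim = Sum.elim (z ∘ Sum.inl) Empty.elim := by
      funext i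
      rcases i with i | i
      · rfl
      · exact i.elim
    rw [e'] at hz'
    beta_reduce at hP
    rw [e, ← hP x _ _ hz, Sum.elim_comp_map]
    rw [← hP x _ _ hz] at hz'
    constructor
    · intro hr
      exact ⟨hn x y hr, (h x _ y (hn x y hr) (hz' (hn x y hr))).1 hr⟩
    · rintro ⟨h1, h2⟩
      exact (h x _ y h1 (hz' h1)).2 h2

/-- Substitution of elements of `S` that are determined by `x`. -/
theorem subst {L : X → (K → S) → Prop} (hL : V.QF Λ L)
    (hP : V.Fib Λ (fun x (_ : Empty → S) => ∃ u, L x u))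
    (hu : ∀ x u u', L x u → L x u' → u = u')
    {R : X × (K → S) → (J → S) → Prop} (h : V.Fib (V.lin Λ K) R) :
    V.Fib Λ (fun x y => ∃ u, L x u ∧ R (x, u) y) := by
  obtain ⟨M, hM, L', D, hL', hD, ht, h⟩ := h
  -- The substituted tuple joins the parameters; uniqueness of `u` makes the relation independent of
  -- the choice.
  refine of_on (K := K ⊕ M) hP
    (L := fun x z => L x (z ∘ Sum.inl) ∧ L' (x, z ∘ Sum.inl) (z ∘ Sum.inr))
    (D := fun z => D (z ∘ Sum.map Sum.inr id))
    ((hL.reindex _).and hL'.uncurry) (hD.reindex _) ?_ ?_ ?_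
  · rintro x ⟨u, hx⟩
    obtain ⟨z, hz⟩ := ht (x, u)
    exact ⟨Sum.elim u z, hx, hz⟩
  · rintro x y ⟨u, hx, _⟩
    exact ⟨u, hx⟩
  · rintro x z y - ⟨h1, h2⟩
    rw [Sum.elim_comp_map, Function.comp_id, ← h _ _ _ h2]
    constructor
    · rintro ⟨u, h3, h4⟩
      rwa [hu x _ _ h1 h3]
    · exact fun h3 => ⟨_, h1, h3⟩

/-- A definable condition on the value of an element. -/
theorem val_rel {l : X → Γ} (hl : l ∈ Λ) {D : (Unit ⊕ J → S) → Prop} (hD : OrdDef D) :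
    V.Fib Λ (fun x y => ∃ v : S, V.val (l x) = v ∧ D (Sum.elim (fun _ => v) y)) := by
  refine of_on (P := fun x => l x ≠ 0) (K := Unit) (of_prop (QF.eq_zero (Tame.of_mem hl)).not)
    (QF.val_eq (Tame.of_mem hl) ()) hD ?_ ?_ ?_
  · intro x hx
    have : V.val (l x) ≠ ⊤ := fun h => hx ((V.val_eq_top _).1 h)
    lift V.val (l x) to S using this with v
    exact ⟨fun _ => v, rfl⟩
  · rintro x y ⟨v, hv, _⟩ h0
    rw [h0, V.val_zero] at hv
    exact WithTop.top_ne_coe hv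
  · intro x z y _ hz
    constructor
    · rintro ⟨v, hv, h⟩
      have : z = fun _ => v := funext fun _ => WithTop.coe_injective (hz.symm.trans hv)
      rwa [this]
    · exact fun h => ⟨z (), hz, h⟩

/-- The value of `l x` serves as a parameter in `S`; `l x = 0` is treated apart since its value is
`⊤`. -/
theorem le_val {l : X → Γ} (hl : l ∈ Λ) (o : Option (J × Bool)) :
    V.Fib Λ (fun x y => V.ev o y ≤ V.val (l x)) := by
  have h := val_rel (V := V) hl (D := fun z : Unit ⊕ J → S =>
    ¬ V.ev (some (Sum.inl (), false)) z < V.ev (o.map (Prod.map Sum.inr id)) z)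
    (V.ordDef_ev_lt _ _).not
  refine ((of_prop (P := fun x => l x = 0) (QF.eq_zero (Tame.of_mem hl))).or h).congr fun x y => ?_
  simp only [ev_map, Sum.elim_comp_inr, not_lt]
  constructor
  · rintro (h | ⟨v, hv, h⟩)
    · rw [h, V.val_zero]
      exact le_top
    · rw [hv]
      exact h
  · intro h
    by_cases h0 : V.val (l x) = ⊤
    · exact Or.inl ((V.val_eq_top _).1 h0)
    · right
      lift V.val (l x) to S using h0 with v
      exact ⟨v, rfl, h⟩

theorem sg_base {l : X → Γ} (hl : l ∈ Λ) (o : Option (J × Bool)) (e : SignType) :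
    V.Fib Λ (fun x y => V.sg (l x) (V.ev o y) = e) := by
  have h := le_val (V := V) hl o
  have hs : V.Fib Λ (fun x (_ : J → S) => SignType.sign (l x) = e) :=
    of_prop ((QF.atom (Tame.of_mem hl) none e).congr fun x z => by simp only [ev, sg_top])
  refine ((h.and (const (0 = e))).or (h.not.and hs)).congr fun x y => ?_
  unfold sg
  split_ifs with h <;> simp [h]

theorem sc_lt_val {l : X → Γ} (hl : l ∈ Λ) (j : J) :
    V.Fib Λ (fun x y => (V.sc (y j) : WithTop S) < V.val (l x)) := by
  have h := val_rel (V := V) hl (D := fun z : Unit ⊕ J → S =>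
    ¬ V.ev (some (Sum.inr j, true)) z < V.ev (some (Sum.inl (), false)) z)
    (V.ordDef_ev_lt _ _).not
  refine h.not.congr fun x y => ?_
  simp only [ev, Sum.elim_inr, Sum.elim_inl, WithTop.coe_lt_coe]
  constructor
  · intro h
    by_cases h0 : V.val (l x) = ⊤
    · rw [h0]
      exact WithTop.coe_lt_top _
    · lift V.val (l x) to S using h0 with v
      by_contra h1
      exact h ⟨v, rfl, fun h2 => h1 (WithTop.coe_lt_coe.2 h2)⟩
  · rintro h ⟨v, hv, h1⟩
    rw [hv, WithTop.coe_lt_coe] at h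
    exact h1 h

/-- The case distinction that decides the position of `l x + c • y j + ⋯`, where `y j` dominates the
remaining terms, in terms of the value of `a x`. -/
theorem dominant_cases {a : X → Γ} (ha : a ∈ Λ) (j : J) (o : Option (J × Bool)) (e : SignType)
    (p : SignType) {f : X → Γ → (J → S) → Prop}
    (hf : V.Fib (V.lin Λ Bool) (fun q y => f q.1 (V.emb (q.2 true)) y)) :
    V.Fib Λ (fun x y =>
      ((V.sc (y j) : WithTop S) < V.val (a x) ∧ (V.ev o y ≤ V.sc (y j) ∧ 0 = e ∨
        ¬ V.ev o y ≤ V.sc (y j) ∧ p = e)) ∨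
      (V.val (a x) < V.sc (y j) ∧ V.sg (a x) (V.ev o y) = e) ∨
      (V.val (a x) = V.sc (y j) ∧ f x (V.emb (y j)) y)) := by
  have hle : V.Fib Λ (fun (_ : X) (y : J → S) => V.ev o y ≤ V.sc (y j)) :=
    (ord (V.ordDef_ev_lt (some (j, true)) o).not).congr fun x y => not_lt
  have heq : V.Fib Λ (fun x (y : J → S) => V.val (a x) = V.sc (y j)) := by
    refine (val_rel ha (D := fun z : Unit ⊕ J → S => z (Sum.inl ()) = V.sc (z (Sum.inr j)))
      (V.ordDef_sc _ _)).congr fun x y => ?_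
    simp
  have hlt := sc_lt_val (V := V) ha j
  have hP : V.Fib Λ (fun x (_ : Empty → S) => ∃ u : Bool → S,
      u false = V.sc (u true) ∧ V.val (a x) = u false) := by
    have hD : OrdDef (fun z : Unit ⊕ Empty → S => ∃ u : Unit → S, z (Sum.inl ()) = V.sc (u ())) :=
      (V.ordDef_sc (Sum.inr () : (Unit ⊕ Empty) ⊕ Unit) (Sum.inl (Sum.inl ()))).exists_sum
    refine (val_rel ha hD).congr fun x y => ?_
    constructor
    · rintro ⟨v, hv, u, hu⟩
      exact ⟨fun b => if b then u () else v, by simpa using hu, by simpa using hv⟩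
    · rintro ⟨u, h1, h2⟩
      exact ⟨u false, h2, fun _ => u true, h1⟩
  -- `u false` is the value of `a x` and `u true` its predecessor. When `V.val (a x) = V.sc (y j)`,
  -- injectivity of `sc` gives `y j = u true`, so `y j` is determined by `x`.
  have hs := subst ((QF.ord (V.ordDef_sc true false)).and (QF.val_eq (Tame.of_mem ha) false))
    hP (fun x u u' h h' => ?_) hf
  · refine ((hlt.and ((hle.and (const (0 = e))).or (hle.not.and (const (p = e))))).or
      (((hlt.or heq).not.and (sg_base ha o e)).or (heq.and hs))).congr fun x y => ?_
    refine or_congr Iff.rfl (or_congr (and_congr_left fun _ => ?_) (and_congr_right fun h => ?_))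
    · rw [not_or, not_lt, lt_iff_le_and_ne]
    · constructor
      · rintro ⟨u, ⟨h1, h2⟩, h3⟩
        have : y j = u true := by
          rw [h, h1, WithTop.coe_inj] at h2
          exact V.sc_injective h2
        rwa [this]
      · exact fun h3 => ⟨fun b => if b then y j else V.sc (y j), ⟨by simp, by simpa using h⟩,
          by simpa using h3⟩
  · have h3 : u false = u' false := WithTop.coe_injective (h.2.symm.trans h'.2)
    have h4 : u true = u' true := V.sc_injective (h.1.symm.trans (h3.trans h'.1))
    funext b
    cases b
    · exact h3
    · exact h4

end Fib
end LogVal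

namespace LogVal

variable {X Γ S : Type u} [AddCommGroup Γ] [LinearOrder Γ] [IsOrderedAddMonoid Γ]
  [LinearOrder S] (V : LogVal Γ S) {J : Type}

/-! ### Positions of linear combinations of embedded elements -/

theorem sc_le_val_emb_sub {b z : S} {w : S} (hb : w ≤ b) (hz : w ≤ z) :
    (V.sc w : WithTop S) ≤ V.val (V.emb z - V.emb b) := by
  have h : ∀ {z b : S}, w ≤ z → z < b → (V.sc w : WithTop S) ≤ V.val (V.emb z - V.emb b) := by
    intro z b hz hzb
    rw [V.val_emb_sub z b hzb, WithTop.coe_le_coe, V.sc_le, V.lt_sc_iff]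
    exact hz
  rcases lt_trichotomy z b with h1 | h1 | h1
  · exact h hz h1
  · rw [h1, sub_self, V.val_zero]
    exact le_top
  · rw [← V.val_neg, neg_sub]
    exact h hb h1

theorem sg_eq_of_val_sign {a : Γ} {v : S} {p : SignType} (hv : V.val a = v)
    (hp : SignType.sign a = p) (w : WithTop S) (e : SignType) :
    V.sg a w = e ↔ (w ≤ v ∧ 0 = e ∨ ¬ w ≤ v ∧ p = e) := by
  unfold sg
  rw [hv, hp]
  split_ifs with h <;> simp [h]

variable [Module ℚ Γ]

/-- Recentring at `b` leaves differences, whose values are known, and one multiple of `emb b` that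
can be absorbed into the group element. -/
theorem sum_smul_emb (F : Finset J) (c : J → ℚ) (y : J → S) (b : S) :
    ∑ k ∈ F, c k • V.emb (y k) =
      ∑ k ∈ F, c k • (V.emb (y k) - V.emb b) + (∑ k ∈ F, c k) • V.emb b := by
  simp only [smul_sub, Finset.sum_sub_distrib, Finset.sum_smul, sub_add_cancel]

theorem sc_le_val_sum {F : Finset J} (c : J → ℚ) {y : J → S} {b w : S} (hb : w ≤ b)
    (hy : ∀ k ∈ F, w ≤ y k) :
    (V.sc w : WithTop S) ≤ V.val (∑ k ∈ F, c k • (V.emb (y k) - V.emb b)) := by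
  refine V.le_val_sum F _ fun k hk => ?_
  by_cases hc : c k = 0
  · simp [hc, V.val_zero]
  · rw [V.val_smul hc]
    exact V.sc_le_val_emb_sub hb (hy k hk)

/-- The `j`-th term has value `sc (y j)` and all others at least `sc (sc (y j))`. The sign is
reversed because `emb (y j) < emb b`. -/
theorem val_sum_of_min {F : Finset J} {c : J → ℚ} {y : J → S} {b : S} {j : J} (hj : j ∈ F)
    (hc : c j ≠ 0) (hy : ∀ k ∈ F, k ≠ j → y j < y k) (hb : y j < b) :
    V.val (∑ k ∈ F, c k • (V.emb (y k) - V.emb b)) = V.sc (y j) ∧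
      SignType.sign (∑ k ∈ F, c k • (V.emb (y k) - V.emb b)) = - SignType.sign (c j) := by
  classical
  rw [← Finset.add_sum_erase F _ hj]
  have h1 : V.val (c j • (V.emb (y j) - V.emb b)) = V.sc (y j) := by
    rw [V.val_smul hc, V.val_emb_sub _ _ hb]
  have h2 : (V.sc (V.sc (y j)) : WithTop S) ≤
      V.val (∑ k ∈ F.erase j, c k • (V.emb (y k) - V.emb b)) :=
    V.sc_le_val_sum c ((V.sc_le _ _).2 hb) fun k hk =>
      (V.sc_le _ _).2 (hy k (Finset.mem_of_mem_erase hk) (Finset.ne_of_mem_erase hk))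
  have h3 := h1.trans_lt ((WithTop.coe_lt_coe.2 (V.lt_sc _)).trans_le h2)
  rw [V.val_add_eq h3, V.sign_add_eq h3, sign_rat_smul,
    sign_neg (sub_neg.2 (V.emb_lt _ _ hb))]
  exact ⟨h1, by simp⟩

/-- The position of `g + ∑ c k • emb (y k)` if `y j` is the least of the `y k` and `a` is chosen as
in the hypotheses. -/
theorem sg_add_sum_iff {F : Finset J} {c : J → ℚ} {y : J → S} {b : S} {j : J} (hj : j ∈ F)
    (hc : c j ≠ 0) (hy : ∀ k ∈ F, k ≠ j → y j < y k) {g a : Γ}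
    (ha : a = g + (∑ k ∈ F, c k) • V.emb b)
    (hb : y j < b ∨ V.val a = b) (w : WithTop S) (e : SignType) :
    V.sg (g + ∑ k ∈ F, c k • V.emb (y k)) w = e ↔
      (((V.sc (y j) : WithTop S) < V.val a ∧ (w ≤ V.sc (y j) ∧ 0 = e ∨
        ¬ w ≤ V.sc (y j) ∧ - SignType.sign (c j) = e)) ∨
      (V.val a < V.sc (y j) ∧ V.sg a w = e) ∨
      (V.val a = V.sc (y j) ∧ V.sg (g + ∑ k ∈ F, c k • V.emb (y k)) w = e)) := by
  set T := ∑ k ∈ F, c k • (V.emb (y k) - V.emb b) with hT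
  have hsum : g + ∑ k ∈ F, c k • V.emb (y k) = a + T := by
    rw [V.sum_smul_emb F c y b, ha]
    abel
  rw [hsum]
  rcases lt_trichotomy (V.sc (y j) : WithTop S) (V.val a) with h | h | h
  · have hb' : y j < b := by
      rcases hb with hb | hb
      · exact hb
      · rw [hb, WithTop.coe_lt_coe] at h
        exact (V.lt_sc _).trans h
    obtain ⟨h1, h2⟩ := V.val_sum_of_min hj hc hy hb'
    have h3 : V.val T < V.val a := by rwa [hT, h1]
    rw [add_comm, V.sg_add_eq h3, V.sg_eq_of_val_sign h1 h2]
    simp [h, h.ne', h.not_gt]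
  · simp [← h]
  · have h3 : V.val a < V.val T := by
      by_cases hb' : y j < b
      · obtain ⟨h1, -⟩ := V.val_sum_of_min hj hc hy hb'
        rwa [hT, h1]
      · have hv := hb.resolve_left hb'
        have hyk : ∀ k ∈ F, b ≤ y k := fun k hk => by
          by_cases hkj : k = j
          · rw [hkj]
            exact not_lt.1 hb'
          · exact (not_lt.1 hb').trans (hy k hk hkj).le
        rw [hv]
        exact (WithTop.coe_lt_coe.2 (V.lt_sc b)).trans_le (V.sc_le_val_sum c le_rfl hyk)
    rw [V.sg_add_eq h3]
    simp [h, h.ne, h.not_gt]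

theorem exists_val_add_smul_emb (g : Γ) {q : ℚ} (hq : q ≠ 0) :
    ∃ b, V.val (g + q • V.emb b) = b := by
  refine ⟨V.int (-(q⁻¹ • g)), ?_⟩
  have h := V.val_int (-(q⁻¹ • g))
  rw [← V.val_smul (neg_ne_zero.2 hq)] at h
  refine Eq.trans (congrArg V.val ?_) h
  rw [smul_sub, smul_neg, neg_smul, neg_smul, neg_neg, smul_inv_smul₀ hq, sub_neg_eq_add]

theorem val_add_smul_emb_unique {g : Γ} {q : ℚ} (hq : q ≠ 0) {b b' : S}
    (h : V.val (g + q • V.emb b) = b) (h' : V.val (g + q • V.emb b') = b') : b = b' := by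
  have key : ∀ {b b' : S}, V.val (g + q • V.emb b) = b → V.val (g + q • V.emb b') = b' →
      ¬ b < b' := by
    intro b b' h h' hlt
    have h1 : (b : WithTop S) < b' := WithTop.coe_lt_coe.2 hlt
    rw [← h', ← V.val_neg] at h1
    rw [← h] at h1
    have h2 := V.val_add_eq h1
    have e : g + q • V.emb b + -(g + q • V.emb b') = q • (V.emb b - V.emb b') := by
      rw [smul_sub]
      abel
    rw [e, V.val_smul hq, V.val_emb_sub _ _ hlt, h, WithTop.coe_inj] at h2
    exact (V.lt_sc b).ne' h2
  exact le_antisymm (not_lt.1 (key h' h)) (not_lt.1 (key h h'))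

namespace Fib

variable {V} {Λ : Submodule ℚ (X → Γ)} [Fintype J]

theorem sg_sum (n : ℕ) : ∀ {X : Type u} {Λ : Submodule ℚ (X → Γ)} (F : Finset J), F.card = n →
    ∀ {l : X → Γ} (_ : l ∈ Λ) (c : J → ℚ) (o : Option (J × Bool)) (e : SignType),
    V.Fib Λ (fun x y => V.sg (l x + ∑ k ∈ F, c k • V.emb (y k)) (V.ev o y) = e) := by
  classical
  induction n with
  | zero =>
    intro X Λ F hF l hl c o e
    rw [Finset.card_eq_zero] at hF
    subst hF
    simpa using sg_base hl o e
  | succ n ih =>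
    intro X Λ F hF l hl c o e
    have hcard : ∀ j ∈ F, (F.erase j).card = n := fun j hj => by
      rw [Finset.card_erase_of_mem hj, hF, Nat.add_sub_cancel]
    have hmin : ∀ j, ∀ {X : Type u} {Λ : Submodule ℚ (X → Γ)}, V.Fib Λ (fun (_ : X) (y : J → S) =>
        ∀ k, k ∈ F → k ≠ j → y j < y k) := fun j X Λ =>
      all (R := fun k (_ : X) (y : J → S) => k ∈ F → k ≠ j → y j < y k)
        fun k => (const (k ∈ F)).imp ((const (k ≠ j)).imp (ord (OrdDef.lt j k)))
    have main : ∀ j ∈ F, V.Fib Λ (fun x y => (∀ k, k ∈ F → k ≠ j → y j < y k) ∧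
        V.sg (l x + ∑ k ∈ F, c k • V.emb (y k)) (V.ev o y) = e) := by
      intro j hj
      by_cases hc : c j = 0
      · refine ((hmin j).and (ih (F.erase j) (hcard j hj) hl c o e)).congr fun x y => ?_
        rw [← Finset.add_sum_erase F _ hj, hc, zero_smul, zero_add]
      have cases : ∀ {X : Type u} {Λ : Submodule ℚ (X → Γ)} {l a : X → Γ} (_ : l ∈ Λ) (_ : a ∈ Λ),
          V.Fib Λ (fun x y => (∀ k, k ∈ F → k ≠ j → y j < y k) ∧
            (((V.sc (y j) : WithTop S) < V.val (a x) ∧ (V.ev o y ≤ V.sc (y j) ∧ 0 = e ∨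
              ¬ V.ev o y ≤ V.sc (y j) ∧ - SignType.sign (c j) = e)) ∨
            (V.val (a x) < V.sc (y j) ∧ V.sg (a x) (V.ev o y) = e) ∨
            (V.val (a x) = V.sc (y j) ∧
              V.sg (l x + ∑ k ∈ F, c k • V.emb (y k)) (V.ev o y) = e))) := by
        intro X Λ l a hl ha
        have hl' : (fun p : X × (Bool → S) => l p.1 + c j • V.emb (p.2 true)) ∈ V.lin Λ Bool :=
          (V.lin Λ Bool).add_mem (V.fst_mem_lin hl)
            ((V.lin Λ Bool).smul_mem (c j) (V.coord_mem_lin true))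
        have h := dominant_cases ha j o e (- SignType.sign (c j))
          (f := fun x b y =>
            V.sg (l x + c j • b + ∑ k ∈ F.erase j, c k • V.emb (y k)) (V.ev o y) = e)
          (ih (F.erase j) (hcard j hj) hl' c o e)
        refine ((hmin j).and h).congr fun x y => ?_
        rw [add_assoc (l x), Finset.add_sum_erase F (fun k => c k • V.emb (y k)) hj]
      by_cases hQ : ∑ k ∈ F, c k = 0
      · refine (cases hl hl).congr fun x y => and_congr_right fun hy => ?_
        exact (V.sg_add_sum_iff hj hc hy (b := V.sc (y j)) (by rw [hQ, zero_smul, add_zero])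
          (Or.inl (V.lt_sc _)) _ _).symm
      · have hl' : (fun p : X × (Unit → S) => l p.1) ∈ V.lin Λ Unit := V.fst_mem_lin hl
        have ha' : (fun p : X × (Unit → S) => l p.1 + (∑ k ∈ F, c k) • V.emb (p.2 ())) ∈
            V.lin Λ Unit := (V.lin Λ Unit).add_mem hl'
            ((V.lin Λ Unit).smul_mem _ (V.coord_mem_lin ()))
        refine (Fib.subst (QF.val_eq (V := V) (Λ := Λ) (J := Unit)
          (f := fun x u => l x + (∑ k ∈ F, c k) • V.emb (u ()))
          ((Tame.of_mem hl).add ((Tame.coord ()).smul _)) ()) ((const True).congr fun x _ => ?_)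
          (fun x u u' h h' => ?_) (cases hl' ha')).congr fun x y => ?_
        · obtain ⟨b, hb⟩ := V.exists_val_add_smul_emb (l x) hQ
          exact ⟨fun _ => ⟨fun _ => b, hb⟩, fun _ => trivial⟩
        · exact funext fun _ => V.val_add_smul_emb_unique hQ h h'
        · constructor
          · rintro ⟨u, hu, hy, h⟩
            exact ⟨hy, (V.sg_add_sum_iff hj hc hy rfl (Or.inr hu) _ _).2 h⟩
          · rintro ⟨hy, h⟩
            obtain ⟨b, hb⟩ := V.exists_val_add_smul_emb (l x) hQ
            exact ⟨fun _ => b, hb, hy, (V.sg_add_sum_iff hj hc hy rfl (Or.inr hb) _ _).1 h⟩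
    have tie : ∀ p : J × J, V.Fib Λ (fun x y => (p.1 ∈ F ∧ p.2 ∈ F ∧ p.1 ≠ p.2) ∧ y p.1 = y p.2 ∧
        V.sg (l x + ∑ k ∈ F, c k • V.emb (y k)) (V.ev o y) = e) := by
      rintro ⟨i, j⟩
      by_cases hp : i ∈ F ∧ j ∈ F ∧ i ≠ j
      · obtain ⟨hi, hj, hij⟩ := hp
        refine ((ord (OrdDef.eq i j)).and (ih (F.erase i) (hcard i hi) hl
          (Function.update c j (c j + c i)) o e)).congr fun x y => ?_
        have hj' : j ∈ F.erase i := Finset.mem_erase.2 ⟨hij.symm, hj⟩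
        simp only [hi, hj, hij, ne_eq, not_false_eq_true, and_self, true_and]
        refine and_congr_right fun hy => ?_
        rw [← Finset.add_sum_erase F _ hi, ← Finset.add_sum_erase _ _ hj',
          ← Finset.add_sum_erase (F.erase i) _ hj', Function.update_self]
        have : ∀ k ∈ (F.erase i).erase j, Function.update c j (c j + c i) k • V.emb (y k) =
            c k • V.emb (y k) := fun k hk => by
          rw [Function.update_of_ne (Finset.ne_of_mem_erase hk)]
        rw [Finset.sum_congr rfl this, hy, ← add_assoc (c i • _), ← add_smul, add_comm (c i)]
      · exact (const False).congr fun x y => by simp only [hp, false_and]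
    have main' : ∀ j : J, V.Fib Λ (fun x y => j ∈ F ∧ (∀ k, k ∈ F → k ≠ j → y j < y k) ∧
        V.sg (l x + ∑ k ∈ F, c k • V.emb (y k)) (V.ev o y) = e) := by
      intro j
      by_cases hj : j ∈ F
      · exact (main j hj).congr fun x y => by simp only [hj, true_and]
      · exact (const False).congr fun x y => by simp only [hj, false_and]
    refine ((ex tie).or (ex main')).congr fun x y => ⟨?_, fun h => ?_⟩
    · rintro (⟨_, _, _, h⟩ | ⟨_, _, _, h⟩) <;> exact h
    · have hne : F.Nonempty := Finset.card_pos.1 (by omega)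
      obtain ⟨j, hj, hmj⟩ := Finset.exists_min_image F y hne
      by_cases hs : ∀ k, k ∈ F → k ≠ j → y j < y k
      · exact Or.inr ⟨j, hj, hs, h⟩
      · push Not at hs
        obtain ⟨k, hk, hkj, hle⟩ := hs
        exact Or.inl ⟨(k, j), ⟨hk, hj, hkj⟩, le_antisymm hle (hmj k hk), h⟩

theorem of_qf {R : X → (J → S) → Prop} (h : V.QF Λ R) : V.Fib Λ R := by
  induction h with
  | ord h => exact ord h
  | atom hf o e =>
    obtain ⟨l, hl, c, hf⟩ := hf
    refine (sg_sum _ Finset.univ rfl hl c o e).congr fun x y => ?_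
    rw [← hf (x, y)]
  | not _ ih => exact ih.not
  | and _ _ ih ih' => exact ih.and ih'

theorem exists_adj {J : Type} {R : X × Γ → (J → S) → Prop} (h : V.Fib (adj Λ) R) :
    V.Fib Λ (fun x y => ∃ g, R (x, g) y) := by
  obtain ⟨K, _, L, D, hL, hD, ht, h⟩ := h
  have h1 := (of_qf hL.exists_adj).reindex (Sum.inr : K → J ⊕ K)
  have h2 : V.Fib Λ (fun (_ : X) (y : J ⊕ K → S) => D (y ∘ Sum.swap)) := ord (hD.reindex _)
  refine (h1.and h2).exists_sum.congr fun x y => ?_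
  have e : ∀ u : K → S, Sum.elim y u ∘ Sum.swap = Sum.elim u y := fun u => by
    funext i
    rcases i with i | i <;> rfl
  simp only [e, Sum.elim_comp_inr]
  constructor
  · rintro ⟨u, ⟨g, hg⟩, hu⟩
    exact ⟨g, (h _ _ _ hg).2 hu⟩
  · rintro ⟨g, hg⟩
    obtain ⟨u, hu⟩ := ht (x, g)
    exact ⟨u, ⟨g, hu⟩, (h _ _ _ hu).1 hg⟩

end Fib
end LogVal

namespace LogVal

variable {X Γ S : Type u} [AddCommGroup Γ] [LinearOrder Γ] [IsOrderedAddMonoid Γ]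
  [LinearOrder S] [Module ℚ Γ] (V : LogVal Γ S) {Λ : Submodule ℚ (X → Γ)} {J : Type}

theorem eq_int_iff (g : Γ) (z : S) : V.val (g - V.emb z) = z ↔ z = V.int g := by
  refine ⟨fun h => ?_, ?_⟩
  · refine V.val_add_smul_emb_unique (g := g) (q := -1) (by norm_num) ?_ ?_
    · rwa [neg_one_smul, ← sub_eq_add_neg]
    · rw [neg_one_smul, ← sub_eq_add_neg]
      exact V.val_int g
  · rintro rfl
    exact V.val_int g

namespace Fib

variable {V}

/-- The fibers over a one point space are definable in the ordered set. -/
theorem ordDef [Subsingleton X] {R : X → (J → S) → Prop} (h : V.Fib Λ R) (x : X) [Finite J] :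
    OrdDef (R x) := by
  obtain ⟨K, _, L, D, -, hD, ht, h⟩ := h
  obtain ⟨z, hz⟩ := ht x
  have h1 : OrdDef (fun w : J ⊕ K → S => ∀ k, w (Sum.inr k) = z k) :=
    OrdDef.all fun k => OrdDef.eq_const _ _
  refine (h1.and (hD.reindex Sum.swap)).exists_sum.congr fun y => ?_
  have e : ∀ u : K → S, Sum.elim y u ∘ Sum.swap = Sum.elim u y := fun u => by
    funext i
    rcases i with i | i <;> rfl
  simp only [e, Sum.elim_inr]
  rw [h x z y hz]
  constructor
  · rintro ⟨u, hu, hd⟩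
    rwa [← show u = z from funext hu]
  · exact fun hd => ⟨z, fun _ => rfl, hd⟩

variable [Fintype J] {f h : X → (J → S) → Γ}

theorem eq (hf : V.Tame Λ f) (hh : V.Tame Λ h) : V.Fib Λ (fun x y => f x y = h x y) :=
  of_qf (QF.eq hf hh)

theorem pos (hf : V.Tame Λ f) : V.Fib Λ (fun x y => 0 < f x y) := of_qf (QF.pos hf)

theorem val_graph (hf : V.Tame Λ f) (hh : V.Tame Λ h) :
    V.Fib Λ (fun x y => ∃ z : S, V.val (f x y) = z ∧ V.emb z = h x y) := by
  have := (of_qf ((QF.val_eq (hf.reindex (Sum.inl : J → J ⊕ Unit)) (Sum.inr ())).and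
    (QF.eq (Tame.coord (Sum.inr ())) (hh.reindex (Sum.inl : J → J ⊕ Unit))))).exists_sum
  refine this.congr fun x y => ?_
  constructor
  · rintro ⟨u, hu⟩
    exact ⟨u (), hu⟩
  · rintro ⟨u, hu⟩
    exact ⟨fun _ => u, hu⟩

theorem int_graph (hf : V.Tame Λ f) (hh : V.Tame Λ h) :
    V.Fib Λ (fun x y => V.emb (V.int (f x y)) = h x y) := by
  refine (val_graph (hf.sub hh) hh).congr fun x y => ?_
  constructor
  · rintro ⟨z, h1, h2⟩
    rw [← h2, V.eq_int_iff] at h1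
    rw [← h1, h2]
  · intro h1
    rw [← h1]
    exact ⟨_, V.val_int _, rfl⟩

theorem sc_graph (hf : V.Tame Λ f) (hh : V.Tame Λ h) :
    V.Fib Λ (fun x y => ∃ z : S, V.emb z = h x y ∧ V.emb (V.sc z) = f x y) := by
  have := (of_qf ((QF.ord (V.ordDef_sc (Sum.inr true) (Sum.inr false))).and
    ((QF.eq (Tame.coord (Sum.inr true)) (hh.reindex (Sum.inl : J → J ⊕ Bool))).and
    (QF.eq (Tame.coord (Sum.inr false)) (hf.reindex (Sum.inl : J → J ⊕ Bool)))))).exists_sum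
  refine this.congr fun x y => ?_
  constructor
  · rintro ⟨u, h1, h2, h3⟩
    refine ⟨u true, h2, Eq.trans (congrArg V.emb ?_) h3⟩
    exact h1.symm
  · rintro ⟨z, h1, h2⟩
    exact ⟨fun b => if b then z else V.sc z, by simp, by simpa using h1, by simpa using h2⟩

end Fib

/-- A function with values in `Γ ∪ {∞}` that is constant `∞` or linear. -/
def TameTop (Λ : Submodule ℚ (X → Γ)) [Fintype J] (f : X → (J → S) → WithTop Γ) : Prop :=
  (∀ x y, f x y = ⊤) ∨ ∃ g, V.Tame Λ g ∧ ∀ x y, f x y = (g x y : Γ)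

theorem TameTop.adj {V : LogVal Γ S} [Fintype J] {f : X → (J → S) → WithTop Γ}
    (hf : V.TameTop Λ f) :
    V.TameTop (LogVal.adj Λ) (fun p y => f p.1 y) := by
  rcases hf with h | ⟨g, hg, h⟩
  · exact Or.inl fun x y => h _ _
  · exact Or.inr ⟨_, hg.adj, fun x y => h _ _⟩

end LogVal

namespace AsymptoticCouple

open LogVal

variable {Γ : Type u} [AddCommGroup Γ] [LinearOrder Γ] [IsOrderedAddMonoid Γ]
  (A : AsymptoticCouple Γ) (hA : A.IsTlogModel) {J : Type} [Fintype J]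

theorem psiTop_eq_coe_iff (a : WithTop Γ) (h : Γ) :
    A.psiTop a = h ↔ ∃ g : Γ, a = g ∧ ∃ z : A.Psi, (A.toLogVal hA).val g = z ∧ (z : Γ) = h := by
  induction a using WithTop.recTopCoe with
  | top => simp [psiTop]
  | coe g =>
    change (if h : g ≠ 0 then (A.psi ⟨g, h⟩ : WithTop Γ) else ⊤) = h ↔
      ∃ g' : Γ, (g : WithTop Γ) = g' ∧ ∃ z : A.Psi, A.toVal g' = z ∧ (z : Γ) = h
    by_cases hg : g = 0
    · simp [hg, A.toVal_zero]
    · rw [dif_pos hg, WithTop.coe_inj]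
      constructor
      · rintro rfl
        exact ⟨g, rfl, _, A.toVal_of_ne hg, rfl⟩
      · rintro ⟨g', e, z, h1, rfl⟩
        rw [WithTop.coe_inj] at e
        subst e
        rw [A.toVal_of_ne hg, WithTop.coe_inj] at h1
        rw [← h1]

open Classical in
theorem predTop_eq_coe_iff (a : WithTop Γ) (h : Γ) :
    A.predTop hA a = h ↔ ∃ g : Γ, a = g ∧ ∃ z : A.Psi, (z : Γ) = h ∧
      (((A.toLogVal hA).sc z : A.Psi) : Γ) = g := by
  induction a using WithTop.recTopCoe with
  | top => simp [predTop]
  | coe g =>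
    change (if g ∈ A.Psi ∧ A.succ hA.integration 0 < g then
      ((Function.invFunOn (A.succ hA.integration) A.Psi g : Γ) : WithTop Γ) else ⊤) = h ↔
      ∃ g' : Γ, (g : WithTop Γ) = g' ∧ ∃ z : A.Psi, (z : Γ) = h ∧ A.succ hA.integration z = g'
    have hb := hA.bijOn_succ
    split_ifs with hg
    · have hg' : g ∈ A.succ hA.integration '' A.Psi := hb.surjOn hg
      rw [WithTop.coe_inj]
      constructor
      · rintro rfl
        exact ⟨g, rfl, ⟨_, Function.invFunOn_mem hg'⟩, rfl, Function.invFunOn_eq hg'⟩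
      · rintro ⟨g', e, z, rfl, h1⟩
        rw [WithTop.coe_inj] at e
        subst e
        exact hb.injOn (Function.invFunOn_mem hg') z.2 ((Function.invFunOn_eq hg').trans h1.symm)
    · refine ⟨fun h => absurd h WithTop.top_ne_coe, ?_⟩
      rintro ⟨g', e, z, rfl, h1⟩
      rw [WithTop.coe_inj] at e
      subst e
      exact absurd (h1 ▸ hb.mapsTo z.2) hg

theorem _root_.WithTop.map_eq_coe_iff {α β : Type*} (f : α → β) (a : WithTop α) (b : β) :
    WithTop.map f a = b ↔ ∃ g : α, a = g ∧ f g = b := by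
  induction a using WithTop.recTopCoe with
  | top => simp
  | coe g => simp

variable [Module ℚ Γ]

theorem divBy_eq_iff (n : ℕ+) (g h : Γ) : A.divBy hA n g = h ↔ g = ((n : ℕ) : ℚ) • h := by
  have h1 : (n : ℕ) • A.divBy hA n g = g := (hA.divisible n g).choose_spec
  rw [Nat.cast_smul_eq_nsmul]
  constructor
  · rintro rfl
    exact h1.symm
  · intro h2
    rw [h2] at h1
    rw [h2]
    exact nsmul_right_injective n.ne_zero h1

theorem fib_term_eq {α : Type*} (t : logLanguage.Term α) :
    letI := A.logStructure hA
    ∀ {X : Type u} {Λ : Submodule ℚ (X → Γ)} (v : α → X → (J → A.Psi) → WithTop Γ),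
      (∀ i, (A.toLogVal hA).TameTop Λ (v i)) → ∀ (h : X → (J → A.Psi) → Γ),
      (A.toLogVal hA).Tame Λ h →
      (A.toLogVal hA).Fib Λ (fun x y => t.realize (fun i => v i x y) = (h x y : Γ)) := by
  let _ := A.logStructure hA
  induction t with
  | var i =>
    intro X Λ v hv h hh
    rcases hv i with hi | ⟨g, hg, hi⟩
    · exact (Fib.const False).congr fun x y => by simp [hi]
    · exact (Fib.eq hg hh).congr fun x y => by simp [hi]
  | func f ts ih =>
    intro X Λ v hv h hh
    have ex : ∀ i {P : X × Γ → (J → A.Psi) → Prop}, (A.toLogVal hA).Fib (adj Λ) P →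
        (A.toLogVal hA).Fib Λ (fun x y => ∃ g : Γ,
          (ts i).realize (fun i => v i x y) = (g : WithTop Γ) ∧ P (x, g) y) := fun i P hP =>
      ((ih i _ (fun i => (hv i).adj) _ Tame.snd).and hP).exists_adj
    cases f with
    | zero =>
      exact (Fib.eq Tame.zero hh).congr fun x y => WithTop.coe_inj.symm
    | infty =>
      exact (Fib.const False).congr fun x y => ⟨False.elim, fun h => WithTop.top_ne_coe h⟩
    | add =>
      refine (ex 0 (ih 1 _ (fun i => (hv i).adj) _ (hh.adj.sub Tame.snd))).congr fun x y => ?_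
      have key : ∀ a b : WithTop Γ, (∃ g : Γ, a = g ∧ b = ((h x y - g : Γ) : WithTop Γ)) ↔
          a + b = (h x y : Γ) := by
        intro a b
        rw [WithTop.add_eq_coe]
        constructor
        · rintro ⟨g, rfl, rfl⟩
          exact ⟨g, _, rfl, rfl, add_sub_cancel _ _⟩
        · rintro ⟨g, g', rfl, rfl, e⟩
          exact ⟨g, rfl, by rw [← e, add_sub_cancel_left]⟩
      exact key ((ts 0).realize (fun i => v i x y)) ((ts 1).realize (fun i => v i x y))
    | neg =>
      refine (ex 0 (Fib.eq Tame.snd.neg hh.adj)).congr fun x y => ?_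
      exact (WithTop.map_eq_coe_iff (fun γ : Γ => -γ) ((ts 0).realize (fun i => v i x y))
        (h x y)).symm
    | psi =>
      refine (ex 0 (Fib.val_graph Tame.snd hh.adj)).congr fun x y => ?_
      exact (A.psiTop_eq_coe_iff hA ((ts 0).realize (fun i => v i x y)) (h x y)).symm
    | succ =>
      refine (ex 0 (Fib.int_graph Tame.snd hh.adj)).congr fun x y => ?_
      exact (WithTop.map_eq_coe_iff (A.succ hA.integration) ((ts 0).realize (fun i => v i x y))
        (h x y)).symm
    | pred =>
      refine (ex 0 (Fib.sc_graph Tame.snd hh.adj)).congr fun x y => ?_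
      exact (A.predTop_eq_coe_iff hA ((ts 0).realize (fun i => v i x y)) (h x y)).symm
    | delta n =>
      refine (ex 0 (Fib.eq Tame.snd (hh.adj.smul ((n : ℕ) : ℚ)))).congr fun x y => ?_
      refine Iff.trans ?_ (WithTop.map_eq_coe_iff (A.divBy hA n) ((ts 0).realize (fun i => v i x y))
        (h x y)).symm
      exact exists_congr fun g => and_congr_right fun _ => (A.divBy_eq_iff hA n g _).symm

theorem fib_realize {α : Type*} {n : ℕ} (φ : logLanguage.BoundedFormula α n) :
    letI := A.logStructure hA
    ∀ {X : Type u} {Λ : Submodule ℚ (X → Γ)} (v : α → X → (J → A.Psi) → WithTop Γ)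
      (w : Fin n → X → (J → A.Psi) → WithTop Γ),
      (∀ i, (A.toLogVal hA).TameTop Λ (v i)) → (∀ i, (A.toLogVal hA).TameTop Λ (w i)) →
      (A.toLogVal hA).Fib Λ (fun x y => φ.Realize (fun i => v i x y) (fun i => w i x y)) := by
  let _ := A.logStructure hA
  have term : ∀ {n : ℕ} (t : logLanguage.Term (α ⊕ Fin n)) {X : Type u} {Λ : Submodule ℚ (X → Γ)}
      (v : α → X → (J → A.Psi) → WithTop Γ) (w : Fin n → X → (J → A.Psi) → WithTop Γ),
      (∀ i, (A.toLogVal hA).TameTop Λ (v i)) → (∀ i, (A.toLogVal hA).TameTop Λ (w i)) →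
      ∀ (h : X → (J → A.Psi) → Γ), (A.toLogVal hA).Tame Λ h →
      (A.toLogVal hA).Fib Λ (fun x y =>
        t.realize (Sum.elim (fun i => v i x y) (fun i => w i x y)) = (h x y : Γ)) := by
    intro n t X Λ v w hv hw h hh
    refine (A.fib_term_eq hA t (Sum.elim v w) (by rintro (i | i) <;> simp [hv, hw]) h hh).congr
      fun x y => ?_
    have : (fun i => Sum.elim v w i x y) = Sum.elim (fun i => v i x y) (fun i => w i x y) := by
      funext i
      rcases i with i | i <;> rfl
    rw [this]
  induction φ with
  | falsum => exact fun _ _ _ _ => Fib.const False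
  | equal t₁ t₂ =>
    intro X Λ v w hv hw
    have hv' := fun i => (hv i).adj
    have hw' := fun i => (hw i).adj
    have h1 := term t₁ _ _ hv' hw' _ Tame.snd
    have h2 := term t₂ _ _ hv' hw' _ Tame.snd
    refine ((h1.and h2).exists_adj.or (h1.exists_adj.not.and h2.exists_adj.not)).congr
      fun x y => ?_
    have key : ∀ a b : WithTop Γ,
        ((∃ g : Γ, a = g ∧ b = g) ∨ (¬ ∃ g : Γ, a = g) ∧ ¬ ∃ g : Γ, b = g) ↔
        a = b := by
      intro a b
      induction a using WithTop.recTopCoe <;> induction b using WithTop.recTopCoe <;>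
        simp [eq_comm]
    exact key (t₁.realize (Sum.elim (fun i => v i x y) (fun i => w i x y)))
      (t₂.realize (Sum.elim (fun i => v i x y) (fun i => w i x y)))
  | rel R ts =>
    intro X Λ v w hv hw
    cases R with
    | lt =>
      have hv' := fun i => (hv i).adj
      have hw' := fun i => (hw i).adj
      have h1 := term (ts 0) _ _ hv' hw' _ Tame.snd
      have h2 := term (ts 1) _ _ (fun i => (hv' i).adj) (fun i => (hw' i).adj) _ Tame.snd
      have h3 := (Fib.pos (V := A.toLogVal hA) (Λ := adj (adj Λ)) (J := J)
        (Tame.snd.sub (Tame.adj Tame.snd))).not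
      refine (h1.and (h2.and h3).exists_adj.not).exists_adj.congr fun x y => ?_
      have key : ∀ a b : WithTop Γ,
          (∃ g : Γ, a = g ∧ ¬ ∃ g' : Γ, b = g' ∧ ¬ 0 < g' - g) ↔ a < b := by
        intro a b
        induction a using WithTop.recTopCoe <;> induction b using WithTop.recTopCoe <;> simp
      exact key ((ts 0).realize (Sum.elim (fun i => v i x y) (fun i => w i x y)))
        ((ts 1).realize (Sum.elim (fun i => v i x y) (fun i => w i x y)))
  | imp _ _ ih₁ ih₂ => exact fun v w hv hw => (ih₁ v w hv hw).imp (ih₂ v w hv hw)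
  | @all n φ ih =>
    intro X Λ v w hv hw
    have snoc : ∀ {Y : Type u} (w : Fin n → Y → (J → A.Psi) → WithTop Γ)
        (f : Y → (J → A.Psi) → WithTop Γ) (x : Y) (y : J → A.Psi),
        (fun i => (Fin.snoc w f : Fin (n + 1) → Y → (J → A.Psi) → WithTop Γ) i x y) =
          Fin.snoc (fun i => w i x y) (f x y) := by
      intro Y w f x y
      funext i
      induction i using Fin.lastCases <;> simp
    have h1 := ih v (Fin.snoc w (fun _ _ => ⊤)) hv (by
      intro i
      induction i using Fin.lastCases with
      | last => exact Or.inl fun x y => by simp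
      | cast i => simpa using hw i)
    have h2 := ih (Λ := adj Λ) (fun i p y => v i p.1 y)
      (Fin.snoc (fun i p y => w i p.1 y) (fun p _ => (p.2 : Γ))) (fun i => (hv i).adj) (by
      intro i
      induction i using Fin.lastCases with
      | last => exact Or.inr ⟨_, Tame.snd, fun x y => by simp⟩
      | cast i => simpa using (hw i).adj)
    refine (h1.and h2.not.exists_adj.not).congr fun x y => ?_
    rw [Language.BoundedFormula.realize_all]
    simp only [snoc, not_exists, not_not]
    constructor
    · rintro ⟨h3, h4⟩ a
      induction a using WithTop.recTopCoe with
      | top => exact h3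
      | coe g => exact h4 g
    · exact fun h => ⟨h _, fun g => h _⟩

end AsymptoticCouple

theorem mainTheorem4 {Γ : Type*} [AddCommGroup Γ] [LinearOrder Γ] [IsOrderedAddMonoid Γ]
    (A : AsymptoticCouple Γ) (hA : A.IsTlogModel) (n : ℕ) (hn : 1 ≤ n)
    (f : (Fin n → A.Psi) → A.Psi) (hf : A.DefinableInCouple hA f) :
    DefinableInOrder f := by
  obtain ⟨_⟩ := nonempty_module_rat hA.divisible
  let _ := A.logStructure hA
  obtain ⟨φ, hφ⟩ := Set.definable_iff_exists_formula_sum.1 hf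
  have h := A.fib_realize hA (J := Fin (n + 1)) φ (X := PUnit) (Λ := ⊤)
    (Sum.elim (fun a _ _ => a) (fun i _ y => ((y i : Γ) : WithTop Γ))) (fun i => i.elim0)
    (by
      rintro (⟨a, _⟩ | i)
      · induction a using WithTop.recTopCoe with
        | top => exact Or.inl fun _ _ => rfl
        | coe g => exact Or.inr ⟨_, LogVal.Tame.of_mem (l := fun _ => g) trivial, fun _ _ => rfl⟩
      · exact Or.inr ⟨_, LogVal.Tame.coord i, fun _ _ => rfl⟩)
    (fun i => i.elim0)
  refine (h.ordDef PUnit.unit).congr fun y => ?_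
  have e1 : (fun i => Sum.elim (fun (a : (Set.univ : Set (WithTop Γ))) _ _ => (a : WithTop Γ))
      (fun (i : Fin (n + 1)) (_ : PUnit) (y : Fin (n + 1) → A.Psi) => ((y i : Γ) : WithTop Γ)) i
      PUnit.unit y) = Sum.elim (fun a : (Set.univ : Set (WithTop Γ)) => (a : WithTop Γ))
        (fun i => ((y i : Γ) : WithTop Γ)) := by
    funext i
    rcases i with i | i <;> rfl
  have e2 := Set.ext_iff.1 hφ (fun i => ((y i : Γ) : WithTop Γ))
  simp only [Set.mem_ofPred_eq] at e2
  have e3 : (φ.Realize (Sum.elim (fun a : (Set.univ : Set (WithTop Γ)) => (a : WithTop Γ))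
        (fun i => ((y i : Γ) : WithTop Γ)))) ↔
      y (Fin.last n) = f (fun i => y i.castSucc) := by
    rw [← e2]
    constructor
    · rintro ⟨x, hx, hl⟩
      have : (fun i : Fin n => y i.castSucc) = x := funext fun i =>
        Subtype.ext (WithTop.coe_injective (hx i))
      rw [this]
      exact Subtype.ext (WithTop.coe_injective hl)
    · intro hl
      exact ⟨fun i => y i.castSucc, fun _ => rfl, by rw [hl]⟩
  rw [← e3, ← e1]
  unfold Language.Formula.Realize
  refine iff_of_eq (congrArg _ (funext fun i => i.elim0))
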